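/- Fix $n\ge 1$ and let $\mathcal A$ be the set of symbols $a_{ij|K}=a_{ji|K}$ with $i\ne j$ in $[n]=\{1,\dots,n\}$ and $K\subseteq[n]\setminus\{i,j\}$; let $p_I$ ($I\subseteq[n]$) be further unknowns. For pairwise distinct $i,j,k\in[n]$ and $M\subseteq[n]\setminus\{i\}$ the *edge trinomial* is $$p_{M\cup i}\,a_{jk|M\setminus\{j,k\}}-p_M\,a_{jk|(M\setminus\{j,k\})\cup i}-a_{ij|M\setminus j}\,a_{ik|M\setminus k}.$$ A *uniform oriented gaussoid* is a map $\phi:\mathcal A\to\{+1,-1\}$ such that, for every edge trinomial, after setting every $p_I$ to $1$ and every $a\in\mathcal A$ to $\phi(a)$, the three terms (with their signs) take both values $+1$ and $-1$. The group $\{\pm1\}^n\rtimes S_n$ acts on maps $\mathcal A\to\{0,\pm1\}$: permutations relabel the indices, and $\varepsilon\in\{\pm1\}^n$ multiplies the value at $a_{ij|K}$ by $\varepsilon_i\varepsilon_j$. Its orbits on uniform oriented gaussoids are called *symmetry classes*. A real positive definite symmetric $n\times n$ matrix $\Sigma$ *realizes* $\phi$ if $\phi(a_{ij|K})$ is the sign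 of the minor of $\Sigma$ with rows $i,K$ and columns $j,K$ (with $i$ and $j$ listed first, and $K$ in increasing order in both), for all $a_{ij|K}\in\mathcal A$; $\phi$ is *realizable* if such a $\Sigma$ exists. Given a uniform oriented gaussoid $\phi$, each edge trinomial can be written, up to a global sign, as $x_1x_2+x_3x_4-x_5x_6$, where each $x_i$ is an unknown $p_I$, or an unknown $a\in\mathcal A$ multiplied by its sign $\phi(a)$; it gives the two formal inequalities $x_1x_2<x_5x_6$ and $x_3x_4<x_5x_6$. A *bi-quadratic final polynomial* for $\phi$ is a non-empty finite collection, repetitions allowed, of such inequalities for which the product of all left-hand sides equals, as a monomial, the product of all right-hand sides. **Theorem.** Let $n=4$. There are exactly $46$ symmetry classes of uniform oriented gaussoids. Each of the $46$ rows of the table below gives a uniform oriented gaussoid, and every symmetry class contains exactly one of them. The signs are listed in the order $$\begin{matrix}a_{12},a_{12|3},a_{12|4},a_{12|34},a_{13},a_{13|2},a_{13|4},a_{13|24},a_{14},a_{14|2},a_{14|3},a_{14|23},\\a_{23},a_{23|1},a_{23|4},a_{23|14},a_{24},a_{24|1},a_{24|3},a_{24|13},a_{34},a_{34|1},a_{34|2},a_{34|12}.\end{matrix}$$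 For each row other than row 36, the symmetric $4\times4$ matrix $\Sigma=(\sigma_{ij})$ with $\sigma_{11}=\sigma_{22}=\sigma_{33}=\sigma_{44}=1$ and $(\sigma_{12},\sigma_{13},\sigma_{14},\sigma_{23},\sigma_{24},\sigma_{34})$ as in the third column is positive definite and realizes the oriented gaussoid of that row. All members of every symmetry class other than that of row 36 are realizable. No member of the class of row 36 is realizable, and each of its members admits a bi-quadratic final polynomial. $$\begin{array}{rll} 1 & ++++++++++++++++++++++++ & (1/8,1/16,1/4,1/4,1/16,1/8)\\ 2 & ++++++++++++------------ & (1/8,1/16,1/4,-1/2,-1/4,-1/16)\\ 3 & +++++++++++++-+---+----- & (1/4,1/2,1/16,1/32,-1/128,-1/2)\\ 4 & +++++++++++++++++++++++- & \tfrac{1}{100}(44,50,51,50,51,30)\\ 5 & ++++++++++-++-++----++++ & (1/4,1/8,1/512,1/128,-1/4,1/8)\\ 6 & ++++++++++--+-+----+++++ & (1/4,1/2,1/128,1/64,-1/32,1/4)\\ 7 & +++++++++++++++-+-+-+-+- & \tfrac{1}{100}(57,57,76,39,12,12)\\ 8 & +++++++++++++++++-+++--- & \tfrac{1}{100}(64,55,60,76,32,6)\\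 9 & +++++++++++++++-+-+----- & (1/16,1/32,1/2,1/64,1/128,-1/2)\\ 10 & +++++++++++++++++-+++-+- & \tfrac{1}{100}(45,57,66,57,26,19)\\ 11 & ++++++++++-++-+++---++++ & \tfrac{1}{100}(75,69,45,45,7,75)\\ 12 & +++++++++++++++---+----- & (1/16,1/8,1/2,1/32,-1/512,-1/2)\\ 13 & ++++++++++--+---++++++++ & (1/16,1/2,1/8,1/512,1/64,1/2)\\ 14 & ++++++++++--+-+-----++++ & (1/8,1/2,1/16,1/64,-1/64,1/4)\\ 15 & +++++++++++-+---+++++-++ & \tfrac{1}{100}(53,76,46,8,71,27)\\ 16 & ++++++++++--++--++++++++ & (1/64,1/8,1/128,1/128,1/8,1/8)\\ 17 & +++++++++++++-+-+-+-+--- & (1/2,1/8,1/8,1/64,1/32,1/4096)\\ 18 & +++++++++++++-+-+-+-+-+- & (1/16,1/2,1/2,1/64,1/128,1/8)\\ 19 & +++++++++++++++--------- & (1/2,1/256,1/64,1/256,-1/128,-1/4)\\ 20 & ++++++++++-++-+-+---++++ & \tfrac{1}{100}(85,67,37,39,6,64)\\ 21 & +++++++++++++++++-+----- & (1/4,1/16,1/2,1/16,1/32,-1/16)\\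 22 & +++++++++++-+---++++++++ & \tfrac{1}{100}(59,59,48,13,59,59)\\ 23 & +++++++++++++++++-++---- & (1/2,1/2,1/8,1/2,1/256,-1/8)\\ 24 & ++++++++++-++-+-+---+++- & \tfrac{1}{100}(81,84,39,43,2,49)\\ 25 & +++++++++++-+-+-+++++-++ & \tfrac{1}{100}(60,85,39,21,55,27)\\ 26 & +++++++++++++++++-+-+-+- & (1/8,1/16,1/8,1/16,1/128,1/512)\\ 27 & ++++++++++--+-+-++-+++++ & (1/4,1/2,1/1024,1/128,1/1024,1/4)\\ 28 & +++++++++++-+++-++++++++ & \tfrac{1}{100}(58,58,41,41,58,58)\\ 29 & +++++++++++++++++++++--- & (1/16,1/8,1/8,1/4,1/4,1/256)\\ 30 & ++++++++++-+--+-----+++- & (1/16,1/8,1/16384,-1/8192,-1/4,1/512)\\ 31 & ++++++++++++++++++++---- & (1/16,1/4,1/8,1/8,1/8,-1/32)\\ 32 & ++++++++++++++---------- & (1/8,1/32,1/2,1/32,-1/8,-1/2)\\ 33 & ++++++++++--+-+-+---++++ & \tfrac{1}{100}(63,70,32,33,4,63)\\ 34 & +++++++++---+---++++++++ & (1/4,1/32,1/256,1/256,1/2,1/2)\\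 35 & +++++++++++++-+-+-+----- & (1/2,1/4,1/4,1/16,1/32,-1/4)\\ 36 & ++++++++++++++--+-+-+-+- & \text{none}\\ 37 & +++++++++++++----------- & (1/2,1/2,1/32,1/128,-1/2,-1/16)\\ 38 & +++++++++++++++++-+-+--- & (1/4,1/4,1/16,1/2,1/256,1/1024)\\ 39 & +++++++-++-++-+++---++++ & \tfrac{1}{100}(83,46,33,33,5,83)\\ 40 & ++++++++++--+---+-++++++ & (1/4,1/2,1/32,1/32768,1/2048,1/4)\\ 41 & +++++++++++-++--++++++++ & \tfrac{1}{100}(46,46,43,30,74,74)\\ 42 & ++++++++++++++++++++++-- & (1/8,1/256,1/8,1/64,1/2,1/256)\\ 43 & ++++++++++--+-+-+--+++++ & (1/4,1/32,1/512,1/512,1/4096,1/2)\\ 44 & +++++++++++++++-+-+-+--- & \tfrac{1}{100}(73,59,71,49,25,6)\\ 45 & ++++++++++-++-+-----++++ & (1/4,1/2,1/64,1/128,-1/4,1/8)\\ 46 & ++++++++++-++-+-----+++- & (1/2,1/2,1/1024,1/256,-1/2,1/8) \end{array}$$ -/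

import Mathlib

open scoped Matrix

/-- The symbols `a_{ij|K}`: an unordered pair `{i, j}` of distinct elements of `Fin n`, stored as a
two-element set, together with a set `K` that contains neither `i` nor `j`. -/
def APSymbol (n : ℕ) : Type :=
  {x : Finset (Fin n) × Finset (Fin n) // x.1.card = 2 ∧ Disjoint x.1 x.2}

namespace APSymbol

instance (n : ℕ) : DecidableEq (APSymbol n) :=
  inferInstanceAs (DecidableEq {x : Finset (Fin n) × Finset (Fin n) //
    x.1.card = 2 ∧ Disjoint x.1 x.2})

instance (n : ℕ) : Fintype (APSymbol n) :=
  inferInstanceAs (Fintype {x : Finset (Fin n) × Finset (Fin n) //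
    x.1.card = 2 ∧ Disjoint x.1 x.2})

/-- The symbol `a_{ij|K}`; by construction `a_{ij|K} = a_{ji|K}`. -/
def of {n : ℕ} (i j : Fin n) (K : Finset (Fin n)) (hij : i ≠ j) (hi : i ∉ K) (hj : j ∉ K) :
    APSymbol n :=
  ⟨({i, j}, K), Finset.card_pair hij, by simp [hi, hj]⟩

/-- The two-element set `{i, j}` of `a_{ij|K}`. -/
def pair {n : ℕ} (x : APSymbol n) : Finset (Fin n) := x.1.1

/-- The conditioning set `K` of `a_{ij|K}`. -/
def cond {n : ℕ} (x : APSymbol n) : Finset (Fin n) := x.1.2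

theorem ext' {n : ℕ} {x y : APSymbol n} (h1 : x.pair = y.pair) (h2 : x.cond = y.cond) : x = y :=
  Subtype.ext (Prod.ext h1 h2)

/-- Permutations of the indices act on symbols: `σ • a_{ij|K} = a_{σ(i)σ(j)|σ(K)}`. -/
instance (n : ℕ) : MulAction (Equiv.Perm (Fin n)) (APSymbol n) where
  smul σ x := ⟨(x.pair.map σ.toEmbedding, x.cond.map σ.toEmbedding),
    by rw [Finset.card_map]; exact x.2.1,
    (Finset.disjoint_map σ.toEmbedding).2 x.2.2⟩
  one_smul x := ext' (Finset.map_refl (s := x.pair)) (Finset.map_refl (s := x.cond))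
  mul_smul σ τ x := ext' (Finset.map_map τ.toEmbedding σ.toEmbedding x.pair).symm
    (Finset.map_map τ.toEmbedding σ.toEmbedding x.cond).symm

theorem pair_smul {n : ℕ} (σ : Equiv.Perm (Fin n)) (x : APSymbol n) :
    (σ • x).pair = x.pair.map σ.toEmbedding := rfl

end APSymbol

/-- Maps from the set of symbols `a_{ij|K}` to `{0, 1, -1}`. -/
abbrev SignMap (n : ℕ) : Type := APSymbol n → SignType

/-- The unknowns `p_I` and `a_{ij|K}`. -/
inductive Unknown (n : ℕ) : Type
  | p (I : Finset (Fin n)) : Unknown n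
  | a (x : APSymbol n) : Unknown n

/-- The inclusion of the group `{1, -1}` into `{0, 1, -1}`. -/
def unitSign : ℤˣ →* SignType where
  toFun u := if u = 1 then 1 else -1
  map_one' := rfl
  map_mul' := by decide

/-- A signed quadratic monomial `± x * y` in the unknowns. -/
structure QuadTerm (n : ℕ) : Type where
  coeff : ℤˣ
  fst : Unknown n
  snd : Unknown n

/-- The underlying monomial `x * y`, as a multiset of unknowns. -/
def QuadTerm.monomial {n : ℕ} (t : QuadTerm n) : Multiset (Unknown n) := {t.fst, t.snd}

/-- The data of an edge trinomial: an edge `{M, M ∪ {i}}` of the `n`-cube inside the 3-face in the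
directions `i, j, k`. -/
structure EdgeIndex (n : ℕ) : Type where
  i : Fin n
  j : Fin n
  k : Fin n
  M : Finset (Fin n)
  hij : i ≠ j
  hik : i ≠ k
  hjk : j ≠ k
  hiM : i ∉ M

/-- The three terms of the edge trinomial
`p_{iM} * a_{jk|M∖jk} - p_M * a_{jk|i(M∖jk)} - a_{ij|M∖j} * a_{ik|M∖k}`.
With `L = M \ {j, k}`, the four possibilities `M = L, jL, kL, jkL` and the choice of the direction
`i` give the twelve trinomials of the 3-face `(ijk, L)`. -/
def EdgeIndex.term {n : ℕ} (e : EdgeIndex n) : Fin 3 → QuadTerm n :=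
  ![⟨1, .p (insert e.i e.M), .a (.of e.j e.k (e.M \ {e.j, e.k}) e.hjk (by simp) (by simp))⟩,
    ⟨-1, .p e.M, .a (.of e.j e.k (insert e.i (e.M \ {e.j, e.k})) e.hjk
      (by simp [e.hij.symm]) (by simp [e.hik.symm]))⟩,
    ⟨-1, .a (.of e.i e.j (e.M.erase e.j) e.hij (by simp [e.hiM]) (by simp)),
      .a (.of e.i e.k (e.M.erase e.k) e.hik (by simp [e.hiM]) (by simp))⟩]

/-- The value of an unknown under a sign map: every `p_I` is set to `1`. -/
def SignMap.unknownSign {n : ℕ} (φ : SignMap n) : Unknown n → SignType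
  | .p _ => 1
  | .a x => φ x

/-- The value of a signed quadratic monomial under a sign map. -/
def SignMap.termSign {n : ℕ} (φ : SignMap n) (t : QuadTerm n) : SignType :=
  unitSign t.coeff * (SignMap.unknownSign φ t.fst * SignMap.unknownSign φ t.snd)

/-- Oriented gaussoids: for every edge trinomial, the set of values of its three terms is
`{0}`, `{-1, 1}` or `{-1, 0, 1}`. -/
def IsOrientedGaussoid {n : ℕ} (φ : SignMap n) : Prop :=
  ∀ e : EdgeIndex n,
    Finset.univ.image (fun t => SignMap.termSign φ (e.term t)) ∈
      ({{0}, {-1, 1}, {-1, 0, 1}} : Set (Finset SignType))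

/-- Uniform oriented gaussoids: those that never take the value `0`. -/
def IsUniformOrientedGaussoid {n : ℕ} (φ : SignMap n) : Prop :=
  IsOrientedGaussoid φ ∧ ∀ x, φ x ≠ 0

/-- The semidirect product `R_n ⋊ S_n` of the reorientation group `R_n = {±1}^n` and the symmetric
group, which permutes the coordinates of `R_n`. -/
abbrev SymGroup (n : ℕ) : Type :=
  (Fin n → ℤˣ) ⋊[mulAutArrow (G := Equiv.Perm (Fin n)) (A := Fin n) (M := ℤˣ)]
    Equiv.Perm (Fin n)

/-- The action of `R_n ⋊ S_n` on sign maps: a permutation relabels the indices, and `ε ∈ R_n`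
multiplies the value at `a_{ij|K}` by `ε i * ε j`. -/
instance (n : ℕ) : MulAction (SymGroup n) (SignMap n) where
  smul g φ := fun x =>
    unitSign (∏ i ∈ x.pair, g.left i) * φ (g.right⁻¹ • x)
  one_smul φ := by
    funext x
    change unitSign (∏ i ∈ x.pair, (1 : ℤˣ)) * φ ((1 : Equiv.Perm (Fin n))⁻¹ • x)
      = φ x
    simp
  mul_smul g h φ := by
    funext x
    change unitSign (∏ i ∈ x.pair, (g.left i * h.left (g.right⁻¹ • i))) *
        φ ((g.right * h.right)⁻¹ • x) =
      unitSign (∏ i ∈ x.pair, g.left i) *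
        (unitSign (∏ i ∈ (g.right⁻¹ • x).pair, h.left i) *
          φ (h.right⁻¹ • g.right⁻¹ • x))
    rw [Finset.prod_mul_distrib, APSymbol.pair_smul, Finset.prod_map, mul_inv_rev, mul_smul,
      map_mul, mul_assoc]
    rfl

/-- The symmetry class of a sign map: its orbit under `R_n ⋊ S_n`. -/
def symmetryClass {n : ℕ} (φ : SignMap n) : Set (SignMap n) := MulAction.orbit (SymGroup n) φ

/-- The set of symmetry classes of uniform oriented gaussoids. -/
def uniformSymmetryClasses (n : ℕ) : Set (Set (SignMap n)) :=
  {O | ∃ φ : SignMap n, IsUniformOrientedGaussoid φ ∧ O = symmetryClass φ}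

/-- The almost-principal minor `a_{ij|K}` of `S`: the determinant of the submatrix with rows
`i, K` and columns `j, K`, where `i` and `j` come first and `K` is listed in the same order in rows
and columns. -/
noncomputable def almostPrincipalMinor {n : ℕ} (S : Matrix (Fin n) (Fin n) ℝ) (i j : Fin n)
    (K : Finset (Fin n)) : ℝ :=
  (S.submatrix (fun r : Option K => r.elim i Subtype.val)
    (fun c : Option K => c.elim j Subtype.val)).det

/-- A positive definite symmetric matrix realizes `φ` if the signs of its almost-principal minors
are the values of `φ`. -/
def Realizes {n : ℕ} (S : Matrix (Fin n) (Fin n) ℝ) (φ : SignMap n) : Prop :=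
  S.PosDef ∧ ∀ (i j : Fin n) (K : Finset (Fin n)) (hij : i ≠ j) (hi : i ∉ K) (hj : j ∉ K),
    SignType.sign (almostPrincipalMinor S i j K) = φ (.of i j K hij hi hj)

/-- Realizability of a sign map. -/
def IsRealizable {n : ℕ} (φ : SignMap n) : Prop :=
  ∃ S : Matrix (Fin n) (Fin n) ℝ, Realizes S φ

/-- The monomial inequality `l < r` (in the absolute values of the unknowns) that can be read off
from an edge trinomial: its terms are written as `x₁x₂ + x₃x₄ - x₅x₆` up to a global sign, where
all `x`'s are positive after multiplication with their signs; then `l = x₁x₂` and `r = x₅x₆`. -/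
def BiquadraticInequality {n : ℕ} (φ : SignMap n) (l r : Multiset (Unknown n)) : Prop :=
  ∃ (e : EdgeIndex n) (s t u : Fin 3), s ≠ t ∧ t ≠ u ∧ s ≠ u ∧
    SignMap.termSign φ (e.term s) ≠ 0 ∧
    SignMap.termSign φ (e.term u) = SignMap.termSign φ (e.term s) ∧
    SignMap.termSign φ (e.term t) = -SignMap.termSign φ (e.term s) ∧
    l = (e.term s).monomial ∧ r = (e.term t).monomial

/-- A bi-quadratic final polynomial for `φ`: a non-empty finite collection, with multiplicities, of
monomial inequalities `l < r` read off from the edge trinomials such that the product of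
all left-hand sides equals the product of all right-hand sides. (Multiplicities are a non-zero
non-negative integral solution of the dual of the linear program in the logarithms.) -/
def HasBiquadraticFinalPolynomial {n : ℕ} (φ : SignMap n) : Prop :=
  ∃ C : Multiset (Multiset (Unknown n) × Multiset (Unknown n)), C ≠ 0 ∧
    (∀ q ∈ C, BiquadraticInequality φ q.1 q.2) ∧
    (C.map Prod.fst).sum = (C.map Prod.snd).sum

/-- The order of the 24 symbols used in the table, as pairs `({i, j}, K)`; the indices `1, 2, 3, 4`
are written `0, 1, 2, 3`. -/
def tableOrder : List (Finset (Fin 4) × Finset (Fin 4)) :=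
  [({0, 1}, ∅), ({0, 1}, {2}), ({0, 1}, {3}), ({0, 1}, {2, 3}),
   ({0, 2}, ∅), ({0, 2}, {1}), ({0, 2}, {3}), ({0, 2}, {1, 3}),
   ({0, 3}, ∅), ({0, 3}, {1}), ({0, 3}, {2}), ({0, 3}, {1, 2}),
   ({1, 2}, ∅), ({1, 2}, {0}), ({1, 2}, {3}), ({1, 2}, {0, 3}),
   ({1, 3}, ∅), ({1, 3}, {0}), ({1, 3}, {2}), ({1, 3}, {0, 2}),
   ({2, 3}, ∅), ({2, 3}, {0}), ({2, 3}, {1}), ({2, 3}, {0, 1})]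

/-- The sign vectors of the table: in row `r`, the decimal digits from left to right are the
values at the symbols in the order `tableOrder`, with `1` for `+` and `0` for `-`. -/
def tableDigits : List ℕ :=
  [111111111111111111111111, 111111111111000000000000, 111111111111101000100000,
    111111111111111111111110, 111111111101101100001111, 111111111100101000011111,
    111111111111111010101010, 111111111111111110111000, 111111111111111010100000,
    111111111111111110111010, 111111111101101110001111, 111111111111111000100000,
    111111111100100011111111, 111111111100101000001111, 111111111110100011111011,
    111111111100110011111111, 111111111111101010101000, 111111111111101010101010,
    111111111111111000000000, 111111111101101010001111, 111111111111111110100000,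
    111111111110100011111111, 111111111111111110110000, 111111111101101010001110,
    111111111110101011111011, 111111111111111110101010, 111111111100101011011111,
    111111111110111011111111, 111111111111111111111000, 111111111101001000001110,
    111111111111111111110000, 111111111111110000000000, 111111111100101010001111,
    111111111000100011111111, 111111111111101010100000, 111111111111110010101010,
    111111111111100000000000, 111111111111111110101000, 111111101101101110001111,
    111111111100100010111111, 111111111110110011111111, 111111111111111111111100,
    111111111100101010011111, 111111111111111010101000, 111111111101101000001111,
    111111111101101000001110]

/-- The sign map of row `r` of the table (rows are numbered from `0`). -/
def tableSign (r : Fin 46) : SignMap 4 := fun x =>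
  if tableDigits.getD r 0 / 10 ^ (23 - tableOrder.idxOf x.1) % 10 = 1 then 1 else -1

/-- The symmetric matrix with ones on the diagonal and the given entries
`σ₁₂, σ₁₃, σ₁₄, σ₂₃, σ₂₄, σ₃₄`. -/
def corrMatrix (s12 s13 s14 s23 s24 s34 : ℚ) : Matrix (Fin 4) (Fin 4) ℚ :=
  !![1, s12, s13, s14;
     s12, 1, s23, s24;
     s13, s23, 1, s34;
     s14, s24, s34, 1]

/-- The matrices of the table. There is no matrix in the 36th row (which has index `35`); the
identity matrix there is a filler that is never used. -/
def tableMatrices : List (Matrix (Fin 4) (Fin 4) ℚ) :=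
  [corrMatrix (1/8) (1/16) (1/4) (1/4) (1/16) (1/8),
    corrMatrix (1/8) (1/16) (1/4) (-1/2) (-1/4) (-1/16),
    corrMatrix (1/4) (1/2) (1/16) (1/32) (-1/128) (-1/2),
    corrMatrix (44/100) (50/100) (51/100) (50/100) (51/100) (30/100),
    corrMatrix (1/4) (1/8) (1/512) (1/128) (-1/4) (1/8),
    corrMatrix (1/4) (1/2) (1/128) (1/64) (-1/32) (1/4),
    corrMatrix (57/100) (57/100) (76/100) (39/100) (12/100) (12/100),
    corrMatrix (64/100) (55/100) (60/100) (76/100) (32/100) (6/100),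
    corrMatrix (1/16) (1/32) (1/2) (1/64) (1/128) (-1/2),
    corrMatrix (45/100) (57/100) (66/100) (57/100) (26/100) (19/100),
    corrMatrix (75/100) (69/100) (45/100) (45/100) (7/100) (75/100),
    corrMatrix (1/16) (1/8) (1/2) (1/32) (-1/512) (-1/2),
    corrMatrix (1/16) (1/2) (1/8) (1/512) (1/64) (1/2),
    corrMatrix (1/8) (1/2) (1/16) (1/64) (-1/64) (1/4),
    corrMatrix (53/100) (76/100) (46/100) (8/100) (71/100) (27/100),
    corrMatrix (1/64) (1/8) (1/128) (1/128) (1/8) (1/8),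
    corrMatrix (1/2) (1/8) (1/8) (1/64) (1/32) (1/4096),
    corrMatrix (1/16) (1/2) (1/2) (1/64) (1/128) (1/8),
    corrMatrix (1/2) (1/256) (1/64) (1/256) (-1/128) (-1/4),
    corrMatrix (85/100) (67/100) (37/100) (39/100) (6/100) (64/100),
    corrMatrix (1/4) (1/16) (1/2) (1/16) (1/32) (-1/16),
    corrMatrix (59/100) (59/100) (48/100) (13/100) (59/100) (59/100),
    corrMatrix (1/2) (1/2) (1/8) (1/2) (1/256) (-1/8),
    corrMatrix (81/100) (84/100) (39/100) (43/100) (2/100) (49/100),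
    corrMatrix (60/100) (85/100) (39/100) (21/100) (55/100) (27/100),
    corrMatrix (1/8) (1/16) (1/8) (1/16) (1/128) (1/512),
    corrMatrix (1/4) (1/2) (1/1024) (1/128) (1/1024) (1/4),
    corrMatrix (58/100) (58/100) (41/100) (41/100) (58/100) (58/100),
    corrMatrix (1/16) (1/8) (1/8) (1/4) (1/4) (1/256),
    corrMatrix (1/16) (1/8) (1/16384) (-1/8192) (-1/4) (1/512),
    corrMatrix (1/16) (1/4) (1/8) (1/8) (1/8) (-1/32),
    corrMatrix (1/8) (1/32) (1/2) (1/32) (-1/8) (-1/2),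
    corrMatrix (63/100) (70/100) (32/100) (33/100) (4/100) (63/100),
    corrMatrix (1/4) (1/32) (1/256) (1/256) (1/2) (1/2),
    corrMatrix (1/2) (1/4) (1/4) (1/16) (1/32) (-1/4),
    corrMatrix 0 0 0 0 0 0,
    corrMatrix (1/2) (1/2) (1/32) (1/128) (-1/2) (-1/16),
    corrMatrix (1/4) (1/4) (1/16) (1/2) (1/256) (1/1024),
    corrMatrix (83/100) (46/100) (33/100) (33/100) (5/100) (83/100),
    corrMatrix (1/4) (1/2) (1/32) (1/32768) (1/2048) (1/4),
    corrMatrix (46/100) (46/100) (43/100) (30/100) (74/100) (74/100),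
    corrMatrix (1/8) (1/256) (1/8) (1/64) (1/2) (1/256),
    corrMatrix (1/4) (1/32) (1/512) (1/512) (1/4096) (1/2),
    corrMatrix (73/100) (59/100) (71/100) (49/100) (25/100) (6/100),
    corrMatrix (1/4) (1/2) (1/64) (1/128) (-1/4) (1/8),
    corrMatrix (1/2) (1/2) (1/1024) (1/256) (-1/2) (1/8)]

/-- The matrix of row `r` of the table (rows are numbered from `0`). -/
def tableMatrix (r : Fin 46) : Matrix (Fin 4) (Fin 4) ℚ := tableMatrices.getD r 1

/-- The quadruples of positions of the symbols `a_{jk|L}`, `a_{jk|iL}`, `a_{ij|M∖j}`,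
`a_{ik|M∖k}` of the edge trinomials for `n = 4`, grouped by the largest position. -/
def edgeBuckets : List (List (ℕ × ℕ × ℕ × ℕ)) :=
  [[],
    [],
    [],
    [],
    [],
    [],
    [],
    [],
    [],
    [],
    [],
    [],
    [(0, 1, 4, 12), (0, 1, 5, 12), (4, 5, 0, 12), (4, 5, 1, 12)],
    [(0, 1, 4, 13), (0, 1, 5, 13), (4, 5, 0, 13), (4, 5, 1, 13), (12, 13, 0, 4), (12, 13, 0, 5),
     (12, 13, 1, 4), (12, 13, 1, 5)],
    [(2, 3, 6, 14), (2, 3, 7, 14), (6, 7, 2, 14), (6, 7, 3, 14)],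
    [(2, 3, 6, 15), (2, 3, 7, 15), (6, 7, 2, 15), (6, 7, 3, 15), (14, 15, 2, 6), (14, 15, 2, 7),
     (14, 15, 3, 6), (14, 15, 3, 7)],
    [(0, 2, 8, 16), (0, 2, 9, 16), (8, 9, 0, 16), (8, 9, 2, 16)],
    [(0, 2, 8, 17), (0, 2, 9, 17), (8, 9, 0, 17), (8, 9, 2, 17), (16, 17, 0, 8), (16, 17, 0, 9),
     (16, 17, 2, 8), (16, 17, 2, 9)],
    [(1, 3, 10, 18), (1, 3, 11, 18), (10, 11, 1, 18), (10, 11, 3, 18)],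
    [(1, 3, 10, 19), (1, 3, 11, 19), (10, 11, 1, 19), (10, 11, 3, 19), (18, 19, 1, 10),
     (18, 19, 1, 11), (18, 19, 3, 10), (18, 19, 3, 11)],
    [(4, 6, 8, 20), (4, 6, 10, 20), (8, 10, 4, 20), (8, 10, 6, 20), (12, 14, 16, 20),
     (12, 14, 18, 20), (16, 18, 12, 20), (16, 18, 14, 20)],
    [(4, 6, 8, 21), (4, 6, 10, 21), (8, 10, 4, 21), (8, 10, 6, 21), (13, 15, 17, 21),
     (13, 15, 19, 21), (17, 19, 13, 21), (17, 19, 15, 21), (20, 21, 4, 8), (20, 21, 4, 10),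
     (20, 21, 6, 8), (20, 21, 6, 10)],
    [(5, 7, 9, 22), (5, 7, 11, 22), (9, 11, 5, 22), (9, 11, 7, 22), (12, 14, 16, 22),
     (12, 14, 18, 22), (16, 18, 12, 22), (16, 18, 14, 22), (20, 22, 12, 16), (20, 22, 12, 18),
     (20, 22, 14, 16), (20, 22, 14, 18)],
    [(5, 7, 9, 23), (5, 7, 11, 23), (9, 11, 5, 23), (9, 11, 7, 23), (13, 15, 17, 23),
     (13, 15, 19, 23), (17, 19, 13, 23), (17, 19, 15, 23), (21, 23, 13, 17), (21, 23, 13, 19),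
     (21, 23, 15, 17), (21, 23, 15, 19), (22, 23, 5, 9), (22, 23, 5, 11), (22, 23, 7, 9),
     (22, 23, 7, 11)]]

/-- The permutations of the 24 positions that are induced by the permutations of the indices. -/
def positionPerms : List (List ℕ) :=
  [[0, 1, 2, 3, 4, 5, 6, 7, 8, 9, 10, 11, 12, 13, 14, 15, 16, 17, 18, 19, 20, 21, 22, 23],
    [0, 2, 1, 3, 8, 9, 10, 11, 4, 5, 6, 7, 16, 17, 18, 19, 12, 13, 14, 15, 20, 21, 22, 23],
    [4, 5, 6, 7, 0, 1, 2, 3, 8, 10, 9, 11, 12, 13, 14, 15, 20, 21, 22, 23, 16, 17, 18, 19],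
    [4, 6, 5, 7, 8, 10, 9, 11, 0, 1, 2, 3, 20, 21, 22, 23, 12, 13, 14, 15, 16, 17, 18, 19],
    [8, 9, 10, 11, 0, 2, 1, 3, 4, 6, 5, 7, 16, 17, 18, 19, 20, 21, 22, 23, 12, 13, 14, 15],
    [8, 10, 9, 11, 4, 6, 5, 7, 0, 2, 1, 3, 20, 21, 22, 23, 16, 17, 18, 19, 12, 13, 14, 15],
    [0, 1, 2, 3, 12, 13, 14, 15, 16, 17, 18, 19, 4, 5, 6, 7, 8, 9, 10, 11, 20, 22, 21, 23],
    [0, 2, 1, 3, 16, 17, 18, 19, 12, 13, 14, 15, 8, 9, 10, 11, 4, 5, 6, 7, 20, 22, 21, 23],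
    [12, 13, 14, 15, 0, 1, 2, 3, 16, 18, 17, 19, 4, 5, 6, 7, 20, 22, 21, 23, 8, 9, 10, 11],
    [12, 14, 13, 15, 16, 18, 17, 19, 0, 1, 2, 3, 20, 22, 21, 23, 4, 5, 6, 7, 8, 9, 10, 11],
    [16, 17, 18, 19, 0, 2, 1, 3, 12, 14, 13, 15, 8, 9, 10, 11, 20, 22, 21, 23, 4, 5, 6, 7],
    [16, 18, 17, 19, 12, 14, 13, 15, 0, 2, 1, 3, 20, 22, 21, 23, 8, 9, 10, 11, 4, 5, 6, 7],
    [4, 5, 6, 7, 12, 13, 14, 15, 20, 21, 22, 23, 0, 1, 2, 3, 8, 10, 9, 11, 16, 18, 17, 19],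
    [4, 6, 5, 7, 20, 21, 22, 23, 12, 13, 14, 15, 8, 10, 9, 11, 0, 1, 2, 3, 16, 18, 17, 19],
    [12, 13, 14, 15, 4, 5, 6, 7, 20, 22, 21, 23, 0, 1, 2, 3, 16, 18, 17, 19, 8, 10, 9, 11],
    [12, 14, 13, 15, 20, 22, 21, 23, 4, 5, 6, 7, 16, 18, 17, 19, 0, 1, 2, 3, 8, 10, 9, 11],
    [20, 21, 22, 23, 4, 6, 5, 7, 12, 14, 13, 15, 8, 10, 9, 11, 16, 18, 17, 19, 0, 1, 2, 3],
    [20, 22, 21, 23, 12, 14, 13, 15, 4, 6, 5, 7, 16, 18, 17, 19, 8, 10, 9, 11, 0, 1, 2, 3],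
    [8, 9, 10, 11, 16, 17, 18, 19, 20, 21, 22, 23, 0, 2, 1, 3, 4, 6, 5, 7, 12, 14, 13, 15],
    [8, 10, 9, 11, 20, 21, 22, 23, 16, 17, 18, 19, 4, 6, 5, 7, 0, 2, 1, 3, 12, 14, 13, 15],
    [16, 17, 18, 19, 8, 9, 10, 11, 20, 22, 21, 23, 0, 2, 1, 3, 12, 14, 13, 15, 4, 6, 5, 7],
    [16, 18, 17, 19, 20, 22, 21, 23, 8, 9, 10, 11, 12, 14, 13, 15, 0, 2, 1, 3, 4, 6, 5, 7],
    [20, 21, 22, 23, 8, 10, 9, 11, 16, 18, 17, 19, 4, 6, 5, 7, 12, 14, 13, 15, 0, 2, 1, 3],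
    [20, 22, 21, 23, 16, 18, 17, 19, 8, 10, 9, 11, 12, 14, 13, 15, 4, 6, 5, 7, 0, 2, 1, 3]]

/-- The sign vectors of the table, as binary codes: bit `q` is set if the sign at position `q`
is `+`. -/
def rowCodes : List ℕ :=
  [16777215, 4095, 286719, 8388607, 15784959, 16274431, 5603327, 1966079, 360447, 6160383,
    15850495, 294911, 16716799, 15750143, 14620671, 16724991, 1400831, 5595135, 32767, 15817727,
    393215, 16717823, 917503, 7429119, 14637055, 5636095, 16471039, 16742399, 2097151, 7359487,
    1048575, 16383, 15815679, 16716287, 352255, 5586943, 8191, 1441791, 15850367, 16585727,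
    16726015, 4194303, 16339967, 1409023, 15752191, 7363583]

/-- For each row of the table and each permutation of the indices, the code of the relabelled and
then normalized sign vector. -/
def orbitCodes : List (List ℕ) :=
  [[16777215, 16777215, 16777215, 16777215, 16777215, 16777215, 16777215, 16777215, 16777215,
     16777215, 16777215, 16777215, 16777215, 16777215, 16777215, 16777215, 16777215, 16777215,
     16777215, 16777215, 16777215, 16777215, 16777215, 16777215],
    [4095, 4095, 4095, 4095, 4095, 4095, 4095, 4095, 4095, 4095, 4095, 4095, 4095, 4095, 4095,
     4095, 4095, 4095, 4095, 4095, 4095, 4095, 4095, 4095],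
    [286719, 348159, 4218879, 4526079, 5263359, 5509119, 15792991, 16713151, 1048053, 1048531,
     16712699, 15793981, 13696863, 14616063, 917493, 1040371, 16581631, 15785791, 3149759,
     3148799, 200699, 16381, 200191, 16351],
    [8388607, 8388607, 16252927, 16744447, 16252927, 16744447, 8388607, 8388607, 16252927,
     16744447, 16252927, 16744447, 16775167, 16777087, 16775167, 16777087, 16777207, 16777207,
     16775167, 16777087, 16775167, 16777087, 16777207, 16777207],
    [15784959, 16584639, 1039871, 917471, 14618619, 13697021, 327647, 1003007, 4259837, 5181435,
     15748095, 15994815, 917471, 1039871, 13697021, 14618619, 15784959, 16584639, 5181435,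
     4259837, 15994815, 15748095, 327647, 1003007],
    [16274431, 16092991, 9393663, 8781663, 6262771, 5832693, 849759, 1033599, 12646389, 13569907,
     15778807, 16518967, 8781663, 9393663, 5832693, 6262771, 16274431, 16092991, 13569907,
     12646389, 16518967, 15778807, 849759, 1033599],
    [5603327, 5726207, 5603327, 5726207, 7692287, 7692287, 4191615, 4192095, 15987703, 16727863,
     15988725, 16727923, 4191615, 4192095, 15987703, 16727863, 15988725, 16727923, 8385887,
     8385887, 16249845, 16744243, 16249845, 16744243],
    [1966079, 2088959, 13762559, 14622719, 15851519, 16588799, 2096639, 2097119, 15858687,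
     16719807, 15859709, 16719867, 12579327, 12582687, 16511487, 16760607, 16515057, 16760817,
     16773599, 16776479, 16773629, 16776987, 16776177, 16777137],
    [360447, 483327, 5275647, 5705727, 7364607, 7671807, 1045887, 1046367, 15791095, 16715575,
     15792117, 16715635, 12648319, 13567999, 851959, 1036279, 16517119, 15781759, 8453983,
     9373183, 589813, 1019891, 16253951, 15765311],
    [6160383, 6283263, 14024703, 14639103, 16113663, 16605183, 4193791, 4194271, 15989759,
     16727999, 15990781, 16728059, 12580351, 12582751, 16511999, 16760639, 16515061, 16760819,
     16774623, 16776543, 16774141, 16777019, 16776181, 16777139],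
    [15850495, 16588735, 2088447, 1966047, 14622715, 13762557, 16511455, 16760095, 12579325,
     12582683, 16759793, 16514993, 1966047, 2088447, 13762557, 14622715, 15850495, 16588735,
     12582683, 12579325, 16514993, 16759793, 16511455, 16760095],
    [294911, 479231, 4227071, 4657151, 7360511, 7606271, 15793023, 16713663, 1048055, 1048535,
     16713723, 15794045, 13696895, 14616575, 917495, 1040375, 16582655, 15785855, 7344063,
     7343103, 462843, 32765, 462335, 32735],
    [16716799, 15859519, 16717311, 15859551, 2097139, 2097141, 15990559, 16724479, 4194289,
     4194289, 16724479, 15990559, 16121631, 16732671, 6291441, 6291441, 16732671, 16121631,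
     2097139, 2097141, 15859519, 16716799, 15859551, 16717311],
    [15750143, 16060223, 1005055, 393055, 6230003, 5308405, 851807, 1033727, 12648437, 13570035,
     15778815, 16518975, 393055, 1005055, 5308405, 6230003, 15750143, 16060223, 13570035,
     12648437, 16518975, 15778815, 851807, 1033727],
    [14620671, 13762431, 16586751, 15851391, 1966071, 2088951, 12058399, 12546559, 8126449,
     8372209, 16478719, 16236319, 16252191, 16740831, 8387569, 8388529, 16740861, 16252699,
     2096631, 2097111, 15858559, 16717759, 15859581, 16717819],
    [16724991, 15990591, 16725503, 15990623, 4194291, 4194293, 15990591, 16724991, 4194291,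
     4194293, 16725503, 15990623, 16121663, 16733183, 6291443, 6291445, 16733695, 16121695,
     6291443, 6291445, 16121663, 16733183, 16121695, 16733695],
    [1400831, 1400831, 5332991, 5578751, 5332991, 5578751, 2094431, 2094431, 15856629, 16719667,
     15856629, 16719667, 4190559, 4191519, 15987189, 16727827, 15987697, 16727857, 4190559,
     4191519, 15987189, 16727827, 15987697, 16727857],
    [5595135, 5595135, 5595135, 5595135, 5595135, 5595135, 4191583, 4191583, 15987701, 16727859,
     15987701, 16727859, 4191583, 4191583, 15987701, 16727859, 15987701, 16727859, 4191583,
     4191583, 15987701, 16727859, 15987701, 16727859],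
    [32767, 462847, 32767, 462847, 7344127, 7344127, 15794047, 16713727, 1048567, 1048567,
     16713727, 15794047, 15794047, 16713727, 1048567, 1048567, 16713727, 15794047, 7344127,
     7344127, 462847, 32767, 462847, 32767],
    [15817727, 16064447, 2055679, 1441759, 6234107, 5373949, 16511327, 16758047, 12579317,
     12582675, 16757745, 16514865, 1965919, 2086399, 13762549, 14622707, 15848447, 16588607,
     4194075, 4190717, 15990705, 16727025, 15987167, 16727327],
    [393215, 1007615, 5308415, 6230015, 15753215, 16060415, 1046015, 1048415, 15791103, 16715583,
     15794165, 16715763, 12648447, 13570047, 851967, 1036287, 16519167, 15781887, 65375, 984575,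
     65525, 987123, 15729663, 15732543],
    [16717823, 15859583, 16717823, 15859583, 2097143, 2097143, 16252703, 16740863, 8388593,
     8388593, 16740863, 16252703, 16252703, 16740863, 8388593, 8388593, 16740863, 16252703,
     2097143, 2097143, 15859583, 16717823, 15859583, 16717823],
    [917503, 1040383, 13697023, 14618623, 15785983, 16584703, 1048063, 1048543, 15793151,
     16715711, 15794173, 16715771, 4259839, 5181439, 327679, 1003519, 15994879, 15749119, 65503,
     986623, 65533, 987131, 15731711, 15732671],
    [7429119, 7675839, 1531391, 1408991, 5709819, 5341181, 8122719, 8369439, 12055029, 12549907,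
     16233457, 16482097, 1963871, 2086271, 13760501, 14622579, 15848439, 16588599, 4192027,
     4190589, 15988657, 16726897, 15987159, 16727319],
    [14637055, 14024575, 16603135, 16113535, 6160375, 6283255, 12058463, 12547583, 8126453,
     8372211, 16479231, 16236351, 16252255, 16741855, 8387573, 8388531, 16741373, 16252731,
     4193783, 4194263, 15989631, 16725951, 15990653, 16726011],
    [5636095, 6250495, 5636095, 6250495, 16080895, 16080895, 4191743, 4194143, 15987711, 16727871,
     15990773, 16728051, 4191743, 4194143, 15987711, 16727871, 15990773, 16728051, 16774495,
     16774495, 16774133, 16777011, 16774133, 16777011],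
    [16471039, 16105279, 12539391, 11927391, 6275059, 6029301, 15989599, 16725439, 4193781,
     4194259, 16724987, 15990589, 14024543, 14636543, 6160373, 6283251, 16602111, 16113471,
     4194227, 4193269, 15990587, 16724989, 15990111, 16725471],
    [16742399, 16252799, 16742399, 16252799, 8388599, 8388599, 16252799, 16742399, 8388599,
     8388599, 16742399, 16252799, 16252799, 16742399, 8388599, 8388599, 16742399, 16252799,
     8388599, 8388599, 16252799, 16742399, 16252799, 16742399],
    [2097151, 2097151, 15859711, 16719871, 15859711, 16719871, 2097151, 2097151, 15859711,
     16719871, 15859711, 16719871, 16773631, 16776991, 16773631, 16776991, 16777201, 16777201,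
     16773631, 16776991, 16773631, 16776991, 16777201, 16777201],
    [7359487, 7606207, 478719, 294879, 4657147, 4227069, 7606207, 7359487, 4657147, 4227069,
     478719, 294879, 16582591, 15784831, 14616571, 13696893, 1039863, 917463, 14616571, 13696893,
     16582591, 15784831, 917463, 1039863],
    [1048575, 1048575, 15794175, 16715775, 15794175, 16715775, 1048575, 1048575, 15794175,
     16715775, 15794175, 16715775, 65535, 987135, 65535, 987135, 15732735, 15732735, 65535,
     987135, 65535, 987135, 15732735, 15732735],
    [16383, 200703, 16383, 200703, 3149823, 3149823, 15793983, 16712703, 1048563, 1048565,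
     16713215, 15794015, 15793983, 16712703, 1048563, 1048565, 16713215, 15794015, 5246975,
     5246975, 331775, 24575, 331775, 24575],
    [15815679, 16064319, 2053631, 1441631, 6234099, 5373941, 15987039, 16725279, 4190709, 4194067,
     16724977, 15990577, 1441631, 2053631, 5373941, 6234099, 15815679, 16064319, 4194067, 4190709,
     15990577, 16724977, 15987039, 16725279],
    [16716287, 15859487, 16716287, 15859487, 2097137, 2097137, 15859487, 16716287, 2097137,
     2097137, 16716287, 15859487, 15859487, 16716287, 2097137, 2097137, 16716287, 15859487,
     2097137, 2097137, 15859487, 16716287, 15859487, 16716287],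
    [352255, 352255, 5267455, 5574655, 5267455, 5574655, 1045855, 1045855, 15791093, 16715571,
     15791093, 16715571, 12648287, 13567487, 851957, 1036275, 16516095, 15781695, 12648287,
     13567487, 851957, 1036275, 16516095, 15781695],
    [5586943, 5464063, 5586943, 5464063, 3497983, 3497983, 4191551, 4191071, 15987699, 16727861,
     15988213, 16727891, 4191551, 4191071, 15987699, 16727861, 15988213, 16727891, 6288735,
     6288735, 16118773, 16736051, 16118773, 16736051],
    [8191, 69631, 8191, 69631, 1052671, 1052671, 15793951, 16712191, 1048561, 1048561, 16712191,
     15793951, 15793951, 16712191, 1048561, 1048561, 16712191, 15793951, 1052671, 1052671, 69631,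
     8191, 69631, 8191],
    [1441791, 2056191, 5373951, 6234111, 15818751, 16064511, 2094591, 2096991, 15856639, 16719679,
     15859701, 16719859, 4190719, 4194079, 15987199, 16727839, 15990769, 16728049, 16773471,
     16774431, 16773621, 16776979, 16774129, 16777009],
    [15850367, 16586687, 2088439, 1966039, 14620667, 13762429, 16478687, 16235807, 12546557,
     12058395, 8371185, 8126385, 1966039, 2088439, 13762429, 14620667, 15850367, 16586687,
     12058395, 12546557, 8126385, 8371185, 16478687, 16235807],
    [16585727, 15851327, 14620159, 13762399, 2088947, 1966069, 15990047, 16724447, 4193265,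
     4194225, 16724477, 15990555, 11927327, 12538367, 6029297, 6275057, 16470527, 16105247,
     2097107, 2096629, 15859517, 16716795, 15858527, 16717247],
    [16726015, 15990655, 16726015, 15990655, 4194295, 4194295, 16252735, 16741375, 8388595,
     8388597, 16741887, 16252767, 16252735, 16741375, 8388595, 8388597, 16741887, 16252767,
     6291447, 6291447, 16121727, 16734207, 16121727, 16734207],
    [4194303, 4194303, 15990783, 16728063, 15990783, 16728063, 6291455, 6291455, 16121855,
     16736255, 16121855, 16736255, 16774143, 16777023, 16774655, 16777055, 16777203, 16777205,
     16774143, 16777023, 16774655, 16777055, 16777203, 16777205],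
    [16339967, 16097087, 10442239, 9830239, 6266867, 5898229, 15989087, 16725407, 4192757,
     4194195, 16724985, 15990585, 9830239, 10442239, 5898229, 6266867, 16339967, 16097087,
     4194195, 4192757, 15990585, 16724985, 15989087, 16725407],
    [1409023, 1531903, 5341183, 5709823, 7430143, 7675903, 2094463, 2094943, 15856631, 16719671,
     15857653, 16719731, 4190591, 4192031, 15987191, 16727831, 15988721, 16727921, 8384863,
     8385823, 16249333, 16744211, 16249841, 16744241],
    [15752191, 16060351, 1007103, 393183, 6230011, 5308413, 327519, 1000959, 4259829, 5181427,
     15746047, 15994687, 917343, 1037823, 13697013, 14618611, 15782911, 16584511, 13570043,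
     12648445, 16519103, 15780863, 851935, 1035775],
    [7363583, 7671743, 482815, 360415, 5705723, 5275645, 8716127, 9389567, 4784117, 5214195,
     16270335, 16027455, 915295, 1037695, 13694965, 14618483, 15782903, 16584503, 13567995,
     12648317, 16517055, 15780735, 851927, 1035767]]

/-- The position of a symbol, given by its two index sets, in the order of the table. -/
def position (x : Finset (Fin 4) × Finset (Fin 4)) : ℕ := tableOrder.idxOf x

/-- The pair of indices `(i, j)` of the symbols `a_{ij|K}` at position `q`. -/
def positionEnds (q : ℕ) : Fin 4 × Fin 4 :=
  [(0, 1), (0, 2), (0, 3), (1, 2), (1, 3), (2, 3)].getD (q / 4) (0, 0)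

/-- The four positions that occur in the edge trinomial with indices `i, j, k, M`. -/
def edgePositions (i j k : Fin 4) (M : Finset (Fin 4)) : ℕ × ℕ × ℕ × ℕ :=
  (position ({j, k}, M \ {j, k}), position ({j, k}, insert i (M \ {j, k})),
    position ({i, j}, M.erase j), position ({i, k}, M.erase k))

/-- The bit at position `q` of the code `v`. -/
def codeBit (v q : ℕ) : Bool := Nat.beq (Nat.land (Nat.shiftRight v q) 1) 1

/-- The sign condition of an edge trinomial, for signs `b q` at the positions `q`. -/
def EdgeOK (b : ℕ → Bool) (c : ℕ × ℕ × ℕ × ℕ) : Bool :=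
  !(b c.1).xor (b c.2.1) || (b c.1).xor ((b c.2.2.1).xor (b c.2.2.2))

/-- Depth-first search through the sign vectors that satisfy the conditions `bs` and are positive
at the positions 0, 4, 8; it checks that every one of them is a member of `cs`. Here `acc` holds
the signs at the first `d` positions. -/
def searchCheck : List (List (ℕ × ℕ × ℕ × ℕ)) → ℕ → ℕ → List ℕ → Bool
  | [], _, acc, cs => cs.any (Nat.beq acc)
  | b :: bs, d, acc, cs =>
    (!b.all (EdgeOK (codeBit (acc + 2 ^ d))) ||
      searchCheck bs (d + 1) (acc + 2 ^ d) (cs.filter fun c => codeBit c d)) &&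
    (Nat.beq d 0 || Nat.beq d 4 || Nat.beq d 8 || !b.all (EdgeOK (codeBit acc)) ||
      searchCheck bs (d + 1) acc (cs.filter fun c => !codeBit c d))

/-- The signs of the reorientation that makes the code `v`, relabelled by `p`, positive at the
positions 0, 4, 8. -/
def normGauge (v : ℕ) (p : List ℕ) (i : Fin 4) : Bool :=
  [true, codeBit v (p.getD 0 0), codeBit v (p.getD 4 0), codeBit v (p.getD 8 0)].getD i.val true

/-- The bit at position `q` of the relabelled and normalized sign vector with code `v`. -/
def normBit (v : ℕ) (p : List ℕ) (q : ℕ) : Bool :=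
  ((normGauge v p (positionEnds q).1).xor (normGauge v p (positionEnds q).2)).xor
    (codeBit v (p.getD q 0))

theorem position_mem (x : APSymbol 4) : x.1 ∈ tableOrder := by
  revert x; decide +kernel

theorem position_lt (x : APSymbol 4) : position x.1 < 24 :=
  List.idxOf_lt_length_iff.2 (position_mem x)

theorem position_injective {x y : APSymbol 4} (h : position x.1 = position y.1) : x = y := by
  have hx := List.getElem_idxOf (position_lt x)
  have hy := List.getElem_idxOf (position_lt y)
  unfold position at h
  simp only [h] at hx
  exact Subtype.ext (hx.symm.trans hy)

theorem exists_position_eq : ∀ q < 24, ∃ x : APSymbol 4, position x.1 = q := by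
  decide +kernel

theorem pair_eq_positionEnds (x : APSymbol 4) :
    x.pair = {(positionEnds (position x.1)).1, (positionEnds (position x.1)).2} ∧
      (positionEnds (position x.1)).1 ≠ (positionEnds (position x.1)).2 := by
  revert x; decide +kernel

theorem edgePositions_mem : ∀ i j k : Fin 4, i ≠ j → i ≠ k → j ≠ k →
    ∀ M ∈ (Finset.univ.erase i).powerset,
    edgePositions i j k M ∈ edgeBuckets.flatten ∨
      ((edgePositions i j k M).1, (edgePositions i j k M).2.1, (edgePositions i j k M).2.2.2,
        (edgePositions i j k M).2.2.1) ∈ edgeBuckets.flatten := by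
  decide +kernel

theorem exists_edgePositions_eq : ∀ c ∈ edgeBuckets.flatten, ∃ i j k : Fin 4,
    i ≠ j ∧ i ≠ k ∧ j ≠ k ∧
    i ∉ (tableOrder.getD c.2.2.1 (∅, ∅)).2 ∪ (tableOrder.getD c.2.2.2 (∅, ∅)).2 ∧
    edgePositions i j k
      ((tableOrder.getD c.2.2.1 (∅, ∅)).2 ∪ (tableOrder.getD c.2.2.2 (∅, ∅)).2) = c := by
  decide +kernel

theorem edgeBuckets_le : ∀ k < 24, ∀ c ∈ edgeBuckets.getD k [],
    c.1 ≤ k ∧ c.2.1 ≤ k ∧ c.2.2.1 ≤ k ∧ c.2.2.2 ≤ k := by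
  decide +kernel

theorem exists_positionPerm (σ : Equiv.Perm (Fin 4)) : ∃ p ∈ positionPerms, ∀ x : APSymbol 4,
    p.getD (position x.1) 0 = position (σ • x).1 := by
  have : ∀ σ : Equiv.Perm (Fin 4), ∃ p ∈ positionPerms, ∀ x : APSymbol 4,
      p.getD (position x.1) 0 =
        position (x.pair.map σ.toEmbedding, x.cond.map σ.toEmbedding) := by
    decide +kernel
  exact this σ

theorem exists_perm_of_mem_positionPerms {p : List ℕ} (hp : p ∈ positionPerms) :
    ∃ σ : Equiv.Perm (Fin 4), ∀ x : APSymbol 4,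
      p.getD (position x.1) 0 = position (σ • x).1 := by
  have : ∀ p ∈ positionPerms, ∃ σ : Equiv.Perm (Fin 4), ∀ x : APSymbol 4,
      p.getD (position x.1) 0 =
        position (x.pair.map σ.toEmbedding, x.cond.map σ.toEmbedding) := by
    decide +kernel
  exact this p hp

theorem searchCheck_orbitCodes : searchCheck edgeBuckets 0 0 orbitCodes.flatten = true := by
  decide +kernel

theorem all_orbitCodes_normBit :
    ((rowCodes.zip orbitCodes).all fun x => (positionPerms.zip x.2).all fun y =>
      (List.range 24).all fun q => (codeBit y.2 q).xor (!normBit x.1 y.1 q)) = true := by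
  decide +kernel

theorem all_orbitCodes_separate :
    ((rowCodes.zip orbitCodes).all fun x => x.2.all fun c =>
      rowCodes.all fun v => !Nat.beq c v || Nat.beq x.1 v) = true := by
  decide +kernel

theorem orbitCodes_lt : ∀ cs ∈ orbitCodes, ∀ c ∈ cs, c < 2 ^ 24 := by
  decide +kernel

theorem rowCodes_lt : ∀ c ∈ rowCodes, c < 2 ^ 24 := by
  decide +kernel

theorem rowCodes_nodup : rowCodes.Nodup := by
  decide +kernel

theorem rowCodes_edgeOK : ∀ v ∈ rowCodes, ∀ c ∈ edgeBuckets.flatten,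
    EdgeOK (codeBit v) c = true := by
  decide +kernel

theorem rowCodes_normalized : ∀ v ∈ rowCodes,
    codeBit v 0 = true ∧ codeBit v 4 = true ∧ codeBit v 8 = true := by
  decide +kernel

theorem tableDigits_eq_one_iff : ∀ r < 46, ∀ q < 24,
    tableDigits.getD r 0 / 10 ^ (23 - q) % 10 = 1 ↔ codeBit (rowCodes.getD r 0) q = true := by
  decide +kernel

theorem length_orbitCodes : ∀ cs ∈ orbitCodes, cs.length = 24 := by
  decide +kernel

theorem codeBit_eq_testBit (v q : ℕ) : codeBit v q = v.testBit q := by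
  change Nat.beq (v >>> q &&& 1) 1 = _
  rw [Nat.testBit, Nat.land_comm]
  have : 1 &&& v >>> q < 2 := lt_of_le_of_lt Nat.and_le_left (by norm_num)
  interval_cases 1 &&& v >>> q <;> rfl

theorem codeBit_add_two_pow {v d : ℕ} (hv : v < 2 ^ d) (q : ℕ) (hq : q < d + 1) :
    codeBit (v + 2 ^ d) q = if q = d then true else codeBit v q := by
  simp only [codeBit_eq_testBit]
  rw [add_comm]
  split_ifs with h
  · subst h
    rw [Nat.testBit_two_pow_add_eq, Nat.testBit_lt_two_pow hv]; rfl
  · exact Nat.testBit_two_pow_add_gt (by omega) v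

theorem codeBit_self_of_lt {v d : ℕ} (hv : v < 2 ^ d) : codeBit v d = false := by
  rw [codeBit_eq_testBit, Nat.testBit_lt_two_pow hv]

theorem eq_of_codeBit_eq {v w : ℕ} (hv : v < 2 ^ 24) (hw : w < 2 ^ 24)
    (h : ∀ q < 24, codeBit v q = codeBit w q) : v = w := by
  refine Nat.eq_of_testBit_eq fun q => ?_
  rcases lt_or_ge q 24 with hq | hq
  · simpa only [codeBit_eq_testBit] using h q hq
  · rw [Nat.testBit_lt_two_pow (hv.trans_le (Nat.pow_le_pow_right (by norm_num) hq)),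
      Nat.testBit_lt_two_pow (hw.trans_le (Nat.pow_le_pow_right (by norm_num) hq))]

theorem EdgeOK_congr {b b' : ℕ → Bool} {c : ℕ × ℕ × ℕ × ℕ} {d : ℕ}
    (hc : c.1 ≤ d ∧ c.2.1 ≤ d ∧ c.2.2.1 ≤ d ∧ c.2.2.2 ≤ d) (h : ∀ q ≤ d, b q = b' q) :
    EdgeOK b c = EdgeOK b' c := by
  unfold EdgeOK
  rw [h _ hc.1, h _ hc.2.1, h _ hc.2.2.1, h _ hc.2.2.2]

/-- Every sign vector that satisfies the edge conditions and is positive at the positions 0, 4, 8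
is found by a successful search. -/
theorem exists_mem_of_searchCheck {b : ℕ → Bool} (h0 : b 0 = true) (h4 : b 4 = true)
    (h8 : b 8 = true) (bs : List (List (ℕ × ℕ × ℕ × ℕ))) :
    ∀ (d acc : ℕ) (cs : List ℕ), (∀ c ∈ bs.flatten, EdgeOK b c = true) →
      (∀ k < bs.length, ∀ c ∈ bs.getD k [],
        c.1 ≤ d + k ∧ c.2.1 ≤ d + k ∧ c.2.2.1 ≤ d + k ∧ c.2.2.2 ≤ d + k) →
      acc < 2 ^ d → (∀ q < d, codeBit acc q = b q) → searchCheck bs d acc cs = true →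
      ∃ c ∈ cs, ∀ q < d + bs.length, codeBit c q = b q := by
  induction bs with
  | nil =>
    intro d acc cs _ _ _ hacc h
    simp only [searchCheck, List.any_eq_true] at h
    obtain ⟨c, hc, hca⟩ := h
    exact ⟨c, hc, by simpa [← Nat.eq_of_beq_eq_true hca] using hacc⟩
  | cons b' bs ih =>
    intro d acc cs hb hle hlt hacc h
    have hle0 := hle 0 (by simp)
    simp only [List.getD_cons_zero, add_zero] at hle0
    have hle' : ∀ k < bs.length, ∀ c ∈ bs.getD k [],
        c.1 ≤ d + 1 + k ∧ c.2.1 ≤ d + 1 + k ∧ c.2.2.1 ≤ d + 1 + k ∧ c.2.2.2 ≤ d + 1 + k := by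
      intro k hk c hc
      have := hle (k + 1) (by simpa using hk) c (by simpa using hc)
      omega
    have hb' : ∀ c ∈ bs.flatten, EdgeOK b c = true := fun c hc =>
      hb c (by rw [List.flatten_cons]; exact List.mem_append_right _ hc)
    have hcb : ∀ c ∈ b', EdgeOK b c = true := fun c hc =>
      hb c (by rw [List.flatten_cons]; exact List.mem_append_left _ hc)
    have step : ∀ acc' : ℕ, (∀ q ≤ d, codeBit acc' q = b q) →
        b'.all (EdgeOK (codeBit acc')) = true := fun acc' hacc' =>
      List.all_eq_true.2 fun c hc => by
        rw [EdgeOK_congr (hle0 c hc) hacc']; exact hcb c hc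
    simp only [searchCheck, Bool.and_eq_true, Bool.or_eq_true] at h
    have hlen : d + (b' :: bs).length = d + 1 + bs.length := by
      rw [List.length_cons]; omega
    rw [hlen]
    cases hbd : b d with
    | true =>
      have hacc' : ∀ q < d + 1, codeBit (acc + 2 ^ d) q = b q := by
        intro q hq
        rw [codeBit_add_two_pow hlt q hq]
        split_ifs with hqd
        · rw [hqd, hbd]
        · exact hacc q (by omega)
      have h1 : searchCheck bs (d + 1) (acc + 2 ^ d) (cs.filter fun c => codeBit c d) = true := by
        rcases h.1 with h1 | h1
        · rw [step _ fun q hq => hacc' q (by omega)] at h1; simp at h1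
        · exact h1
      obtain ⟨c, hc, hcb⟩ := ih (d + 1) _ _ hb' hle' (by rw [pow_succ]; omega) hacc' h1
      exact ⟨c, (List.mem_filter.1 hc).1, hcb⟩
    | false =>
      have hacc' : ∀ q < d + 1, codeBit acc q = b q := by
        intro q hq
        rcases Nat.lt_succ_iff_lt_or_eq.1 hq with hq | rfl
        · exact hacc q hq
        · rw [hbd, codeBit_self_of_lt hlt]
      have h1 : searchCheck bs (d + 1) acc (cs.filter fun c => !codeBit c d) = true := by
        rcases h.2 with (((h1 | h1) | h1) | h1) | h1
        · rw [Nat.eq_of_beq_eq_true h1, h0] at hbd; simp at hbd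
        · rw [Nat.eq_of_beq_eq_true h1, h4] at hbd; simp at hbd
        · rw [Nat.eq_of_beq_eq_true h1, h8] at hbd; simp at hbd
        · rw [step _ fun q hq => hacc' q (by omega)] at h1; simp at h1
        · exact h1
      obtain ⟨c, hc, hcb⟩ := ih (d + 1) _ _ hb' hle' (by rw [pow_succ]; omega) hacc' h1
      exact ⟨c, (List.mem_filter.1 hc).1, hcb⟩

/-- The bits of a sign map on four indices: bit `q` is set if the sign at position `q` is `+`. -/
noncomputable def signBits (φ : SignMap 4) (q : ℕ) : Bool :=
  open Classical in decide (∃ x, position x.1 = q ∧ φ x = 1)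

theorem signBits_position (φ : SignMap 4) (x : APSymbol 4) :
    signBits φ (position x.1) = decide (φ x = 1) := by
  unfold signBits
  rw [decide_eq_decide]
  exact ⟨fun ⟨y, hy, h⟩ => position_injective hy ▸ h, fun h => ⟨x, rfl, h⟩⟩

theorem eq_of_signBits_eq {φ ψ : SignMap 4} (hφ : ∀ x, φ x ≠ 0) (hψ : ∀ x, ψ x ≠ 0)
    (h : ∀ q < 24, signBits φ q = signBits ψ q) : φ = ψ := by
  funext x
  have := h _ (position_lt x)
  rw [signBits_position, signBits_position, decide_eq_decide] at this
  have h1 := hφ x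
  have h2 := hψ x
  generalize φ x = a at *
  generalize ψ x = b at *
  revert a b
  decide

theorem edge_image_mem_iff {n : ℕ} (φ : SignMap n) (hφ : ∀ x, φ x ≠ 0) (e : EdgeIndex n) :
    Finset.univ.image (fun t => SignMap.termSign φ (e.term t)) ∈
      ({{0}, {-1, 1}, {-1, 0, 1}} : Set (Finset SignType)) ↔
    (!(decide (φ (.of e.j e.k (e.M \ {e.j, e.k}) e.hjk (by simp) (by simp)) = 1)).xor
        (decide (φ (.of e.j e.k (insert e.i (e.M \ {e.j, e.k})) e.hjk
          (by simp [e.hij.symm]) (by simp [e.hik.symm])) = 1)) ||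
      (decide (φ (.of e.j e.k (e.M \ {e.j, e.k}) e.hjk (by simp) (by simp)) = 1)).xor
        ((decide (φ (.of e.i e.j (e.M.erase e.j) e.hij (by simp [e.hiM]) (by simp)) = 1)).xor
          (decide (φ (.of e.i e.k (e.M.erase e.k) e.hik (by simp [e.hiM]) (by simp)) = 1)))) =
      true := by
  have key : (fun t => SignMap.termSign φ (e.term t)) =
      ![unitSign 1 * (1 * φ (.of e.j e.k (e.M \ {e.j, e.k}) e.hjk (by simp) (by simp))),
        unitSign (-1) * (1 * φ (.of e.j e.k (insert e.i (e.M \ {e.j, e.k})) e.hjk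
          (by simp [e.hij.symm]) (by simp [e.hik.symm]))),
        unitSign (-1) * (φ (.of e.i e.j (e.M.erase e.j) e.hij (by simp [e.hiM]) (by simp)) *
          φ (.of e.i e.k (e.M.erase e.k) e.hik (by simp [e.hiM]) (by simp)))] := by
    funext t
    fin_cases t <;> rfl
  rw [key]
  clear key
  have h1 := hφ (.of e.j e.k (e.M \ {e.j, e.k}) e.hjk (by simp) (by simp))
  have h2 := hφ (.of e.j e.k (insert e.i (e.M \ {e.j, e.k})) e.hjk
    (by simp [e.hij.symm]) (by simp [e.hik.symm]))
  have h3 := hφ (.of e.i e.j (e.M.erase e.j) e.hij (by simp [e.hiM]) (by simp))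
  have h4 := hφ (.of e.i e.k (e.M.erase e.k) e.hik (by simp [e.hiM]) (by simp))
  generalize φ _ = a at *
  generalize φ _ = b at *
  generalize φ _ = c at *
  generalize φ _ = d at *
  simp only [Set.mem_insert_iff, Set.mem_singleton_iff]
  have key : ∀ s : SignType, s ≠ 0 → s = 1 ∨ s = -1 := by decide
  rcases key a h1 with rfl | rfl <;> rcases key b h2 with rfl | rfl <;>
    rcases key c h3 with rfl | rfl <;> rcases key d h4 with rfl | rfl <;> decide

theorem isOrientedGaussoid_iff (φ : SignMap 4) (hφ : ∀ x, φ x ≠ 0) :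
    IsOrientedGaussoid φ ↔
      ∀ e : EdgeIndex 4, EdgeOK (signBits φ) (edgePositions e.i e.j e.k e.M) = true := by
  refine forall_congr' fun e => ?_
  rw [edge_image_mem_iff φ hφ e]
  simp only [← signBits_position]
  rfl

theorem EdgeOK_swap (b : ℕ → Bool) (c : ℕ × ℕ × ℕ × ℕ) :
    EdgeOK b (c.1, c.2.1, c.2.2.2, c.2.2.1) = EdgeOK b c := by
  simp [EdgeOK, Bool.xor_comm (b c.2.2.1)]

theorem isUniformOrientedGaussoid_iff (φ : SignMap 4) :
    IsUniformOrientedGaussoid φ ↔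
      (∀ x, φ x ≠ 0) ∧ ∀ c ∈ edgeBuckets.flatten, EdgeOK (signBits φ) c = true := by
  unfold IsUniformOrientedGaussoid
  rw [and_comm]
  refine and_congr_right fun hφ => ?_
  rw [isOrientedGaussoid_iff φ hφ]
  constructor
  · intro h c hc
    obtain ⟨i, j, k, hij, hik, hjk, hiM, he⟩ := exists_edgePositions_eq c hc
    rw [← he]
    exact h ⟨i, j, k, _, hij, hik, hjk, hiM⟩
  · intro h e
    rcases edgePositions_mem e.i e.j e.k e.hij e.hik e.hjk e.M
      (Finset.mem_powerset.2 fun x hx => Finset.mem_erase.2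
        ⟨fun hxi => e.hiM (hxi ▸ hx), Finset.mem_univ _⟩) with h1 | h1
    · exact h _ h1
    · rw [← EdgeOK_swap]; exact h _ h1

theorem edgeBuckets_flatten_le {c : ℕ × ℕ × ℕ × ℕ} (hc : c ∈ edgeBuckets.flatten) :
    c.1 ≤ 23 ∧ c.2.1 ≤ 23 ∧ c.2.2.1 ≤ 23 ∧ c.2.2.2 ≤ 23 := by
  obtain ⟨l, hl, hcl⟩ := List.mem_flatten.1 hc
  obtain ⟨k, hk, rfl⟩ := List.getElem_of_mem hl
  have hk' : k < 24 := hk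
  have := edgeBuckets_le k hk' c (by rwa [List.getD_eq_getElem _ _ hk])
  omega

theorem tableSign_ne_zero (r : Fin 46) (x : APSymbol 4) : tableSign r x ≠ 0 := by
  unfold tableSign
  split_ifs <;> decide

theorem signBits_tableSign (r : Fin 46) (q : ℕ) (hq : q < 24) :
    signBits (tableSign r) q = codeBit (rowCodes.getD r 0) q := by
  obtain ⟨x, rfl⟩ := exists_position_eq q hq
  rw [signBits_position, Bool.eq_iff_iff, decide_eq_true_iff,
    ← tableDigits_eq_one_iff r r.2 _ hq]
  unfold tableSign
  split_ifs with h
  · exact iff_of_true rfl h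
  · exact iff_of_false (by decide) h

theorem rowCodes_getD_mem (r : Fin 46) : rowCodes.getD r 0 ∈ rowCodes := by
  rw [List.getD_eq_getElem (hn := r.2)]
  exact List.getElem_mem _

theorem isUniformOrientedGaussoid_tableSign (r : Fin 46) :
    IsUniformOrientedGaussoid (tableSign r) := by
  refine (isUniformOrientedGaussoid_iff _).2 ⟨tableSign_ne_zero r, fun c hc => ?_⟩
  rw [EdgeOK_congr (edgeBuckets_flatten_le hc)
    fun q hq => signBits_tableSign r q (by omega)]
  exact rowCodes_edgeOK _ (rowCodes_getD_mem r) c hc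

theorem smul_signMap_apply {n : ℕ} (g : SymGroup n) (φ : SignMap n) (x : APSymbol n) :
    (g • φ) x = unitSign (∏ i ∈ x.pair, g.left i) * φ (g.right⁻¹ • x) := rfl

theorem unitSign_ne_zero : ∀ u : ℤˣ, unitSign u ≠ 0 := by decide

theorem smul_signMap_ne_zero {n : ℕ} (g : SymGroup n) {φ : SignMap n} (hφ : ∀ x, φ x ≠ 0)
    (x : APSymbol n) : (g • φ) x ≠ 0 := by
  rw [smul_signMap_apply]
  exact mul_ne_zero (unitSign_ne_zero _) (hφ _)

theorem signBits_smul (g : SymGroup 4) {φ : SignMap 4} (hφ : ∀ x, φ x ≠ 0) (x : APSymbol 4) :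
    signBits (g • φ) (position x.1) =
      ((decide (g.left (positionEnds (position x.1)).1 = 1)).xor
        (decide (g.left (positionEnds (position x.1)).2 = 1))).xor
        (signBits φ (position (g.right⁻¹ • x).1)) := by
  rw [signBits_position, signBits_position, smul_signMap_apply]
  obtain ⟨h1, h2⟩ := pair_eq_positionEnds x
  rw [h1, Finset.prod_pair h2]
  have h3 := hφ (g.right⁻¹ • x)
  generalize φ _ = a at *
  generalize g.left _ = u
  generalize g.left _ = v
  revert a u v
  decide

theorem mem_zip_codes (r : Fin 46) :
    (rowCodes.getD r 0, orbitCodes.getD r []) ∈ rowCodes.zip orbitCodes := by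
  have h : (r : ℕ) < (rowCodes.zip orbitCodes).length := r.2
  have := List.getElem_mem h
  rwa [List.getElem_zip, ← List.getD_eq_getElem _ 0, ← List.getD_eq_getElem _ []] at this

theorem orbitCodes_getD_mem (r : Fin 46) : orbitCodes.getD r [] ∈ orbitCodes := by
  rw [List.getD_eq_getElem (hn := r.2)]
  exact List.getElem_mem _

theorem codeBit_eq_normBit {r : Fin 46} {k : ℕ} (hk : k < 24) {q : ℕ} (hq : q < 24) :
    codeBit ((orbitCodes.getD r []).getD k 0) q =
      normBit (rowCodes.getD r 0) (positionPerms.getD k []) q := by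
  have h := List.all_eq_true.1 all_orbitCodes_normBit _ (mem_zip_codes r)
  have hl := length_orbitCodes _ (orbitCodes_getD_mem r)
  have hk' : k < (positionPerms.zip (orbitCodes.getD r [])).length := by
    rw [List.length_zip, hl]; exact hk
  have h2 := List.all_eq_true.1 h _ (List.getElem_mem hk')
  have h3 := List.all_eq_true.1 h2 q (List.mem_range.2 hq)
  rw [List.getElem_zip] at h3
  rw [List.getD_eq_getElem _ _ (hn := by rw [hl]; exact hk),
    List.getD_eq_getElem positionPerms _ (hn := hk)]
  revert h3
  generalize codeBit _ _ = a
  generalize normBit _ _ _ = b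
  revert a b
  decide

theorem eq_of_getD_rowCodes_eq {r s : Fin 46} (h : rowCodes.getD r 0 = rowCodes.getD s 0) :
    r = s := by
  rw [List.getD_eq_getElem (hn := r.2), List.getD_eq_getElem (hn := s.2)] at h
  exact Fin.ext ((rowCodes_nodup.getElem_inj_iff).1 h)

theorem tableSign_orbit_injective {r s : Fin 46} {g : SymGroup 4}
    (h : g • tableSign r = tableSign s) : r = s := by
  obtain ⟨p, hp, hpσ⟩ := exists_positionPerm g.right⁻¹
  obtain ⟨k, hk, rfl⟩ := List.getElem_of_mem hp
  have hk : k < 24 := hk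
  rw [← List.getD_eq_getElem _ [] hk] at hpσ
  set p := positionPerms.getD k [] with hpdef
  have hrel : ∀ q < 24, codeBit (rowCodes.getD s 0) q =
      ((decide (g.left (positionEnds q).1 = 1)).xor
        (decide (g.left (positionEnds q).2 = 1))).xor
        (codeBit (rowCodes.getD r 0) (p.getD q 0)) := by
    intro q hq
    obtain ⟨x, rfl⟩ := exists_position_eq q hq
    rw [← signBits_tableSign s _ hq, ← h, signBits_smul g (tableSign_ne_zero r), hpσ,
      signBits_tableSign r _ (position_lt _)]
  have hgauge : ∀ i : Fin 4, normGauge (rowCodes.getD r 0) p i =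
      (true.xor (decide (g.left 0 = 1))).xor (decide (g.left i = 1)) := by
    obtain ⟨h0, h4, h8⟩ := rowCodes_normalized _ (rowCodes_getD_mem s)
    have e0 := hrel 0 (by norm_num)
    have e4 := hrel 4 (by norm_num)
    have e8 := hrel 8 (by norm_num)
    rw [h0] at e0; rw [h4] at e4; rw [h8] at e8
    intro i
    fin_cases i
    · change true = (true.xor (decide (g.left 0 = 1))).xor (decide (g.left 0 = 1))
      cases decide (g.left 0 = 1) <;> rfl
    · change codeBit _ _ = _
      change true = ((decide (g.left 0 = 1)).xor (decide (g.left 1 = 1))).xor _ at e0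
      change _ = (true.xor (decide (g.left 0 = 1))).xor (decide (g.left 1 = 1))
      revert e0
      cases codeBit (rowCodes.getD r 0) (p.getD 0 0) <;> cases decide (g.left 0 = 1) <;>
        cases decide (g.left 1 = 1) <;> decide
    · change codeBit _ _ = _
      change true = ((decide (g.left 0 = 1)).xor (decide (g.left 2 = 1))).xor _ at e4
      change _ = (true.xor (decide (g.left 0 = 1))).xor (decide (g.left 2 = 1))
      revert e4
      cases codeBit (rowCodes.getD r 0) (p.getD 4 0) <;> cases decide (g.left 0 = 1) <;>
        cases decide (g.left 2 = 1) <;> decide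
    · change codeBit _ _ = _
      change true = ((decide (g.left 0 = 1)).xor (decide (g.left 3 = 1))).xor _ at e8
      change _ = (true.xor (decide (g.left 0 = 1))).xor (decide (g.left 3 = 1))
      revert e8
      cases codeBit (rowCodes.getD r 0) (p.getD 8 0) <;> cases decide (g.left 0 = 1) <;>
        cases decide (g.left 3 = 1) <;> decide
  have hbits : ∀ q < 24, codeBit ((orbitCodes.getD r []).getD k 0) q =
      codeBit (rowCodes.getD s 0) q := by
    intro q hq
    rw [codeBit_eq_normBit hk hq, hrel q hq, normBit, ← hpdef, hgauge, hgauge]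
    generalize decide (g.left 0 = 1) = a
    generalize decide (g.left _ = 1) = b
    generalize decide (g.left _ = 1) = c
    generalize codeBit _ _ = d
    revert a b c d
    decide
  have hkl : k < (orbitCodes.getD r []).length := by
    rw [length_orbitCodes _ (orbitCodes_getD_mem r)]; exact hk
  have hmem : (orbitCodes.getD r []).getD k 0 ∈ orbitCodes.getD r [] := by
    rw [List.getD_eq_getElem _ _ (hn := hkl)]; exact List.getElem_mem _
  have heq := eq_of_codeBit_eq (orbitCodes_lt _ (orbitCodes_getD_mem r) _ hmem)
    (rowCodes_lt _ (rowCodes_getD_mem s)) hbits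
  have h1 := List.all_eq_true.1 all_orbitCodes_separate _ (mem_zip_codes r)
  have h2 := List.all_eq_true.1 h1 _ hmem
  have h3 := List.all_eq_true.1 h2 _ (rowCodes_getD_mem s)
  rw [heq, Nat.beq_refl, Bool.not_true, Bool.false_or] at h3
  exact eq_of_getD_rowCodes_eq (Nat.eq_of_beq_eq_true h3)

/-- The relabelling of an edge trinomial by a permutation of the indices. -/
def EdgeIndex.map {n : ℕ} (σ : Equiv.Perm (Fin n)) (e : EdgeIndex n) : EdgeIndex n where
  i := σ e.i
  j := σ e.j
  k := σ e.k
  M := e.M.map σ.toEmbedding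
  hij := σ.injective.ne e.hij
  hik := σ.injective.ne e.hik
  hjk := σ.injective.ne e.hjk
  hiM := by simp [e.hiM]

/-- The relabelling of unknowns by a permutation of the indices. -/
def Unknown.map {n : ℕ} (σ : Equiv.Perm (Fin n)) : Unknown n → Unknown n
  | .p I => .p (I.map σ.toEmbedding)
  | .a x => .a (σ • x)

theorem APSymbol.of_congr {n : ℕ} {i j i' j' : Fin n} {K K' : Finset (Fin n)} (hi : i = i')
    (hj : j = j') (hK : K = K') (h1 h2 h3 h1' h2' h3') :
    APSymbol.of i j K h1 h2 h3 = APSymbol.of i' j' K' h1' h2' h3' := by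
  subst hi hj hK; rfl

theorem APSymbol.smul_of {n : ℕ} (σ : Equiv.Perm (Fin n)) (i j : Fin n) (K : Finset (Fin n))
    (h1 h2 h3) :
    σ • APSymbol.of i j K h1 h2 h3 = APSymbol.of (σ i) (σ j) (K.map σ.toEmbedding)
      (σ.injective.ne h1) (by simpa using h2) (by simpa using h3) := by
  refine APSymbol.ext' ?_ rfl
  change ({i, j} : Finset (Fin n)).map σ.toEmbedding = {σ i, σ j}
  simp

theorem APSymbol.pair_of {n : ℕ} (i j : Fin n) (K : Finset (Fin n)) (h1 h2 h3) :
    (APSymbol.of i j K h1 h2 h3).pair = {i, j} := rfl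

theorem EdgeIndex.map_term {n : ℕ} (σ : Equiv.Perm (Fin n)) (e : EdgeIndex n) (t : Fin 3) :
    (e.map σ).term t = ⟨(e.term t).coeff, (e.term t).fst.map σ, (e.term t).snd.map σ⟩ := by
  have h1 : (e.M \ {e.j, e.k}).map σ.toEmbedding =
      e.M.map σ.toEmbedding \ {σ e.j, σ e.k} := by
    rw [Finset.map_sdiff]
    simp
  have h2 : ∀ x : Fin n, (e.M.erase x).map σ.toEmbedding = (e.M.map σ.toEmbedding).erase (σ x) := by
    intro x
    rw [Finset.map_erase]; rfl
  fin_cases t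
  · change QuadTerm.mk _ _ _ = QuadTerm.mk _ _ _
    congr 1
    · change Unknown.p _ = Unknown.p _
      congr 1
      rw [Finset.map_insert]; rfl
    · change Unknown.a _ = Unknown.a _
      rw [APSymbol.smul_of]
      congr 1
      exact APSymbol.of_congr rfl rfl h1.symm _ _ _ _ _ _
  · change QuadTerm.mk _ _ _ = QuadTerm.mk _ _ _
    congr 1
    change Unknown.a _ = Unknown.a _
    rw [APSymbol.smul_of]
    congr 1
    refine APSymbol.of_congr rfl rfl ?_ _ _ _ _ _ _
    rw [Finset.map_insert, h1]; rfl
  · change QuadTerm.mk _ _ _ = QuadTerm.mk _ _ _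
    congr 1
    · change Unknown.a _ = Unknown.a _
      rw [APSymbol.smul_of]
      congr 1
      exact APSymbol.of_congr rfl rfl (h2 _).symm _ _ _ _ _ _
    · change Unknown.a _ = Unknown.a _
      rw [APSymbol.smul_of]
      congr 1
      exact APSymbol.of_congr rfl rfl (h2 _).symm _ _ _ _ _ _

theorem EdgeIndex.map_inv_map {n : ℕ} (σ : Equiv.Perm (Fin n)) (e : EdgeIndex n) :
    (e.map σ⁻¹).map σ = e := by
  obtain ⟨i, j, k, M, _, _, _, _⟩ := e
  have hM : (M.map (σ⁻¹).toEmbedding).map σ.toEmbedding = M := by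
    ext x
    rw [Finset.mem_map_equiv, Finset.mem_map_equiv]
    exact iff_of_eq (congrArg (· ∈ M) (σ.apply_symm_apply x))
  simp [EdgeIndex.map, hM]

theorem smul_signMap_of {n : ℕ} (g : SymGroup n) (φ : SignMap n) (i j : Fin n)
    (K : Finset (Fin n)) (h1 h2 h3) :
    (g • φ) (g.right • APSymbol.of i j K h1 h2 h3) =
      unitSign (g.left (g.right i) * g.left (g.right j)) * φ (APSymbol.of i j K h1 h2 h3) := by
  rw [smul_signMap_apply, inv_smul_smul, APSymbol.smul_of, APSymbol.pair_of,
    Finset.prod_pair (g.right.injective.ne h1)]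

/-- A symmetry multiplies the signs of the terms of an edge trinomial by a common sign. -/
theorem termSign_smul {n : ℕ} (g : SymGroup n) (φ : SignMap n) (e : EdgeIndex n) (t : Fin 3) :
    SignMap.termSign (g • φ) ((e.map g.right).term t) =
      unitSign (g.left (g.right e.j) * g.left (g.right e.k)) *
        SignMap.termSign φ (e.term t) := by
  rw [EdgeIndex.map_term]
  fin_cases t
  · change _ * (1 * (g • φ) (g.right • APSymbol.of _ _ _ _ _ _)) = _ * (_ * (1 * φ _))
    rw [smul_signMap_of]
    ac_rfl
  · change _ * (1 * (g • φ) (g.right • APSymbol.of _ _ _ _ _ _)) = _ * (_ * (1 * φ _))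
    rw [smul_signMap_of]
    ac_rfl
  · change _ * ((g • φ) (g.right • APSymbol.of _ _ _ _ _ _) *
      (g • φ) (g.right • APSymbol.of _ _ _ _ _ _)) = _ * (_ * (φ _ * φ _))
    rw [smul_signMap_of, smul_signMap_of]
    have h : unitSign (g.left (g.right e.i)) * unitSign (g.left (g.right e.i)) = 1 := by
      rw [← map_mul, Int.units_mul_self, map_one]
    simp only [map_mul]
    calc _ = (unitSign (g.left (g.right e.i)) * unitSign (g.left (g.right e.i))) * _ := by
          rw [mul_mul_mul_comm, mul_mul_mul_comm (unitSign (g.left (g.right e.i))), mul_assoc,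
            mul_left_comm, ← mul_assoc]
      _ = _ := by rw [h, one_mul]; ac_rfl

theorem IsUniformOrientedGaussoid.smul {n : ℕ} {φ : SignMap n}
    (hφ : IsUniformOrientedGaussoid φ) (g : SymGroup n) : IsUniformOrientedGaussoid (g • φ) := by
  refine ⟨fun e => ?_, smul_signMap_ne_zero g hφ.2⟩
  have h := hφ.1 (e.map g.right⁻¹)
  have h2 : (fun t => SignMap.termSign (g • φ) (e.term t)) = fun t =>
      unitSign (g.left (g.right (e.map g.right⁻¹).j) * g.left (g.right (e.map g.right⁻¹).k)) *
        SignMap.termSign φ ((e.map g.right⁻¹).term t) := by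
    funext t
    rw [← termSign_smul, EdgeIndex.map_inv_map]
  rw [h2]
  generalize g.left _ * g.left _ = u
  have h3 : Finset.univ.image (fun t => unitSign u *
      SignMap.termSign φ ((e.map g.right⁻¹).term t)) = (Finset.univ.image fun t =>
      SignMap.termSign φ ((e.map g.right⁻¹).term t)).image fun s => unitSign u * s := by
    rw [Finset.image_image]; rfl
  rw [h3]
  simp only [Set.mem_insert_iff, Set.mem_singleton_iff] at h ⊢
  clear h2 h3
  rcases h with h | h | h <;> rw [h] <;> revert u <;> decide

theorem biquadraticInequality_smul {n : ℕ} (g : SymGroup n) {φ : SignMap n}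
    {l r : Multiset (Unknown n)} (h : BiquadraticInequality φ l r) :
    BiquadraticInequality (g • φ) (l.map (Unknown.map g.right)) (r.map (Unknown.map g.right)) := by
  obtain ⟨e, s, t, u, hst, htu, hsu, h0, h1, h2, rfl, rfl⟩ := h
  refine ⟨e.map g.right, s, t, u, hst, htu, hsu, ?_, ?_, ?_, ?_, ?_⟩
  · rw [termSign_smul]
    exact mul_ne_zero (unitSign_ne_zero _) h0
  · rw [termSign_smul, termSign_smul, h1]
  · rw [termSign_smul, termSign_smul, h2]
    generalize unitSign _ = a
    generalize SignMap.termSign _ _ = b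
    revert a b; decide
  · rw [EdgeIndex.map_term]; simp [QuadTerm.monomial]
  · rw [EdgeIndex.map_term]; simp [QuadTerm.monomial]

theorem HasBiquadraticFinalPolynomial.smul {n : ℕ} {φ : SignMap n}
    (h : HasBiquadraticFinalPolynomial φ) (g : SymGroup n) :
    HasBiquadraticFinalPolynomial (g • φ) := by
  obtain ⟨C, hC, hq, hsum⟩ := h
  refine ⟨C.map (Prod.map (Multiset.map (Unknown.map g.right))
    (Multiset.map (Unknown.map g.right))), by simpa using hC, ?_, ?_⟩
  · intro q hqC
    obtain ⟨q', hq', rfl⟩ := Multiset.mem_map.1 hqC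
    exact biquadraticInequality_smul g (hq q' hq')
  · rw [Multiset.map_map, Multiset.map_map]
    have := congrArg (Multiset.mapAddMonoidHom (Unknown.map g.right)) hsum
    rw [map_multiset_sum, map_multiset_sum, Multiset.map_map, Multiset.map_map] at this
    exact this

theorem exists_tableSign_smul_eq {φ : SignMap 4} (hφ : IsUniformOrientedGaussoid φ) :
    ∃ (r : Fin 46) (g : SymGroup 4), φ = g • tableSign r := by
  have hne := hφ.2
  let ε : Fin 4 → ℤˣ := fun i =>
    if [true, signBits φ 0, signBits φ 4, signBits φ 8].getD i true then 1 else -1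
  let g₀ : SymGroup 4 := ⟨ε, 1⟩
  have hψ := hφ.smul g₀
  have hψb : ∀ q < 24, signBits (g₀ • φ) q = ((decide (ε (positionEnds q).1 = 1)).xor
      (decide (ε (positionEnds q).2 = 1))).xor (signBits φ q) := by
    intro q hq
    obtain ⟨x, rfl⟩ := exists_position_eq q hq
    rw [signBits_smul g₀ hne]
    rw [show g₀.right⁻¹ • x = x from by rw [show g₀.right = 1 from rfl, inv_one, one_smul]]
  have hdec : ∀ b : Bool, decide ((if b = true then (1 : ℤˣ) else -1) = 1) = b := by decide
  have hxor : ∀ b : Bool, (true.xor b).xor b = true := by decide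
  have h0 : signBits (g₀ • φ) 0 = true := by
    rw [hψb 0 (by norm_num)]
    change ((decide ((if true = true then (1 : ℤˣ) else -1) = 1)).xor
      (decide ((if signBits φ 0 = true then (1 : ℤˣ) else -1) = 1))).xor _ = _
    rw [hdec, hdec, hxor]
  have h4 : signBits (g₀ • φ) 4 = true := by
    rw [hψb 4 (by norm_num)]
    change ((decide ((if true = true then (1 : ℤˣ) else -1) = 1)).xor
      (decide ((if signBits φ 4 = true then (1 : ℤˣ) else -1) = 1))).xor _ = _
    rw [hdec, hdec, hxor]
  have h8 : signBits (g₀ • φ) 8 = true := by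
    rw [hψb 8 (by norm_num)]
    change ((decide ((if true = true then (1 : ℤˣ) else -1) = 1)).xor
      (decide ((if signBits φ 8 = true then (1 : ℤˣ) else -1) = 1))).xor _ = _
    rw [hdec, hdec, hxor]
  obtain ⟨c, hc, hcb⟩ := exists_mem_of_searchCheck h0 h4 h8 edgeBuckets 0 0 orbitCodes.flatten
    ((isUniformOrientedGaussoid_iff _).1 hψ).2
    (fun k hk c hc => by rw [zero_add]; exact edgeBuckets_le k hk c hc) (by norm_num)
    (fun q hq => absurd hq (Nat.not_lt_zero q)) searchCheck_orbitCodes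
  have hcb : ∀ q < 24, codeBit c q = signBits (g₀ • φ) q := hcb
  obtain ⟨cs, hcs, hccs⟩ := List.mem_flatten.1 hc
  obtain ⟨r, hr, rfl⟩ := List.getElem_of_mem hcs
  obtain ⟨k, hk, rfl⟩ := List.getElem_of_mem hccs
  have hk' : k < 24 := by rwa [length_orbitCodes _ hcs] at hk
  let r' : Fin 46 := ⟨r, hr⟩
  have hbits : ∀ q < 24, signBits (g₀ • φ) q =
      normBit (rowCodes.getD r' 0) (positionPerms.getD k []) q := by
    intro q hq
    rw [← codeBit_eq_normBit hk' hq, ← hcb q hq]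
    change _ = codeBit ((orbitCodes.getD r []).getD k 0) q
    rw [List.getD_eq_getElem orbitCodes _ hr, List.getD_eq_getElem _ _ hk]
  have hp : positionPerms.getD k [] ∈ positionPerms := by
    rw [List.getD_eq_getElem (hn := hk')]; exact List.getElem_mem _
  obtain ⟨σ, hσ⟩ := exists_perm_of_mem_positionPerms hp
  set p := positionPerms.getD k []
  let δ : Fin 4 → ℤˣ := fun i => if normGauge (rowCodes.getD r' 0) p i then 1 else -1
  let g₁ : SymGroup 4 := ⟨δ, σ⁻¹⟩
  refine ⟨r', g₀⁻¹ * g₁, ?_⟩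
  rw [mul_smul, eq_inv_smul_iff]
  refine eq_of_signBits_eq hψ.2 (smul_signMap_ne_zero _ (tableSign_ne_zero r')) ?_
  intro q hq
  rw [hbits q hq]
  obtain ⟨x, rfl⟩ := exists_position_eq q hq
  rw [signBits_smul g₁ (tableSign_ne_zero r'), signBits_tableSign r' _ (position_lt _)]
  change _ = ((decide ((if _ = true then (1 : ℤˣ) else -1) = 1)).xor
      (decide ((if _ = true then (1 : ℤˣ) else -1) = 1))).xor
      (codeBit _ (position (σ⁻¹⁻¹ • x).1))
  rw [hdec, hdec, inv_inv, ← hσ, normBit]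

/-- The action of a symmetry on matrices: permute the indices and rescale rows and columns by
signs. -/
def symMatrix {n : ℕ} (g : SymGroup n) (S : Matrix (Fin n) (Fin n) ℝ) :
    Matrix (Fin n) (Fin n) ℝ :=
  fun i j => ((g.left i : ℤ) : ℝ) * (((g.left j : ℤ) : ℝ) * S (g.right⁻¹ i) (g.right⁻¹ j))

theorem units_int_cast_mul_self (u : ℤˣ) : ((u : ℤ) : ℝ) * ((u : ℤ) : ℝ) = 1 := by
  rcases Int.units_eq_one_or u with rfl | rfl <;> simp

theorem sign_units_int_cast (u : ℤˣ) : SignType.sign (((u : ℤ) : ℝ)) = unitSign u := by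
  rcases Int.units_eq_one_or u with rfl | rfl
  · simp
  · simp; rfl

theorem posDef_symMatrix {n : ℕ} (g : SymGroup n) {S : Matrix (Fin n) (Fin n) ℝ}
    (hS : S.PosDef) : (symMatrix g S).PosDef := by
  have h1 : (S.submatrix ⇑g.right⁻¹ ⇑g.right⁻¹).PosDef := hS.submatrix (g.right⁻¹).injective
  let D : Matrix (Fin n) (Fin n) ℝ := Matrix.diagonal fun i => ((g.left i : ℤ) : ℝ)
  have hD : D * D = 1 := by
    rw [Matrix.diagonal_mul_diagonal]
    simp only [units_int_cast_mul_self, Matrix.diagonal_one]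
  have hinj : Function.Injective D.mulVec := by
    intro x y hxy
    have := congrArg D.mulVec hxy
    simpa [Matrix.mulVec_mulVec, hD] using this
  have h2 := h1.conjTranspose_mul_mul_same hinj
  convert h2 using 1
  ext i j
  rw [Matrix.diagonal_conjTranspose, Matrix.mul_diagonal, Matrix.diagonal_mul]
  simp only [symMatrix, Matrix.submatrix_apply, star_trivial, mul_assoc]
  rw [mul_comm (((g.left j : ℤ) : ℝ))]

theorem almostPrincipalMinor_map {n : ℕ} (σ : Equiv.Perm (Fin n))
    (S : Matrix (Fin n) (Fin n) ℝ) (i j : Fin n) (K : Finset (Fin n)) :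
    almostPrincipalMinor (S.submatrix σ σ) i j K =
      almostPrincipalMinor S (σ i) (σ j) (K.map σ.toEmbedding) := by
  let e : K ≃ K.map σ.toEmbedding :=
    Equiv.ofBijective (fun k => ⟨σ k, Finset.mem_map_of_mem σ.toEmbedding k.2⟩) ⟨fun a b h =>
      Subtype.ext (σ.injective (congrArg Subtype.val h)), fun ⟨b, hb⟩ => by
        obtain ⟨a, ha, rfl⟩ := Finset.mem_map.1 hb
        exact ⟨⟨a, ha⟩, rfl⟩⟩
  unfold almostPrincipalMinor
  rw [← Matrix.det_submatrix_equiv_self e.optionCongr]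
  congr 1
  ext a b
  cases a <;> cases b <;> rfl

theorem almostPrincipalMinor_scale {n : ℕ} (ε : Fin n → ℤˣ) (S : Matrix (Fin n) (Fin n) ℝ)
    (i j : Fin n) (K : Finset (Fin n)) :
    almostPrincipalMinor (fun a b => ((ε a : ℤ) : ℝ) * (((ε b : ℤ) : ℝ) * S a b)) i j K =
      ((ε i * ε j : ℤˣ) : ℤ) * almostPrincipalMinor S i j K := by
  let v : Fin n → Option K → ℝ := fun i r => ((ε (r.elim i Subtype.val) : ℤ) : ℝ)
  have h : almostPrincipalMinor (fun a b => ((ε a : ℤ) : ℝ) * (((ε b : ℤ) : ℝ) * S a b)) i j K =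
      (∏ r, v i r) * ((∏ c, v j c) * almostPrincipalMinor S i j K) := by
    unfold almostPrincipalMinor
    rw [← Matrix.det_mul_row, ← Matrix.det_mul_column]
    rfl
  rw [h, Fintype.prod_option, Fintype.prod_option]
  have h2 : (∏ k : K, v i (some k)) * (∏ k : K, v j (some k)) = 1 := by
    rw [← Finset.prod_mul_distrib]
    exact Finset.prod_eq_one fun k _ => units_int_cast_mul_self _
  have h3 : (((ε i * ε j : ℤˣ) : ℤ) : ℝ) = v i none * v j none := by
    push_cast; rfl
  rw [h3]
  linear_combination (v i none * v j none * almostPrincipalMinor S i j K) * h2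

theorem Realizes.smul {n : ℕ} {S : Matrix (Fin n) (Fin n) ℝ} {φ : SignMap n}
    (h : Realizes S φ) (g : SymGroup n) : Realizes (symMatrix g S) (g • φ) := by
  refine ⟨posDef_symMatrix g h.1, fun i j K hij hi hj => ?_⟩
  have h1 : almostPrincipalMinor (symMatrix g S) i j K =
      ((g.left i * g.left j : ℤˣ) : ℤ) *
        almostPrincipalMinor (S.submatrix ⇑g.right⁻¹ ⇑g.right⁻¹) i j K :=
    almostPrincipalMinor_scale g.left (S.submatrix ⇑g.right⁻¹ ⇑g.right⁻¹) i j K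
  rw [h1, almostPrincipalMinor_map, sign_mul, sign_units_int_cast, smul_signMap_apply,
    APSymbol.smul_of, APSymbol.pair_of, Finset.prod_pair hij]
  congr 1
  exact h.2 _ _ _ _ _ _

theorem IsRealizable.smul {n : ℕ} {φ : SignMap n} (h : IsRealizable φ) (g : SymGroup n) :
    IsRealizable (g • φ) :=
  let ⟨_, hS⟩ := h
  ⟨_, hS.smul g⟩

theorem almostPrincipalMinor_eq_det_fin {n m : ℕ} (S : Matrix (Fin n) (Fin n) ℝ) (i j : Fin n)
    (K : Finset (Fin n)) (v : Fin m → Fin n) (hv : Function.Injective v)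
    (hK : K = Finset.univ.image v) :
    almostPrincipalMinor S i j K =
      (S.submatrix (Fin.cons i v : Fin (m + 1) → Fin n) (Fin.cons j v)).det := by
  subst hK
  let e : Fin m ≃ Finset.univ.image v :=
    Equiv.ofBijective (fun k => ⟨v k, Finset.mem_image_of_mem v (Finset.mem_univ k)⟩)
      ⟨fun a b h => hv (congrArg Subtype.val h), fun ⟨b, hb⟩ => by
        obtain ⟨a, -, rfl⟩ := Finset.mem_image.1 hb
        exact ⟨a, rfl⟩⟩
  unfold almostPrincipalMinor
  rw [← Matrix.det_submatrix_equiv_self ((finSuccEquiv m).trans e.optionCongr)]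
  congr 1
  ext a b
  refine Fin.cases ?_ (fun a => ?_) a <;> refine Fin.cases ?_ (fun b => ?_) b <;>
    simp [e] <;> rfl

/-- The expanded minor with rows `i, K` and columns `j, K`, for at most two elements listed
in `K`. -/
def listMinor {n : ℕ} {R : Type*} [CommRing R] (S : Matrix (Fin n) (Fin n) R) (i j : Fin n) :
    List (Fin n) → R
  | [] => S i j
  | [k] => S i j * S k k - S i k * S k j
  | [k, l] => S i j * (S k k * S l l - S k l * S l k) - S i k * (S k j * S l l - S k l * S l j) +
      S i l * (S k j * S l k - S k k * S l j)
  | _ => 0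

theorem almostPrincipalMinor_empty {n : ℕ} (S : Matrix (Fin n) (Fin n) ℝ) (i j : Fin n) :
    almostPrincipalMinor S i j ∅ = listMinor S i j [] := by
  rw [almostPrincipalMinor_eq_det_fin S i j ∅ ![] (fun a => a.elim0) rfl]
  exact Matrix.det_fin_one _

theorem almostPrincipalMinor_singleton {n : ℕ} (S : Matrix (Fin n) (Fin n) ℝ) (i j k : Fin n) :
    almostPrincipalMinor S i j {k} = listMinor S i j [k] := by
  rw [almostPrincipalMinor_eq_det_fin S i j {k} ![k]
    (fun a b _ => Subsingleton.elim a b) (by ext; simp [eq_comm]), Matrix.det_fin_two]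
  rfl

theorem almostPrincipalMinor_pair {n : ℕ} (S : Matrix (Fin n) (Fin n) ℝ) (i j : Fin n)
    {k l : Fin n} (hkl : k ≠ l) : almostPrincipalMinor S i j {k, l} = listMinor S i j [k, l] := by
  rw [almostPrincipalMinor_eq_det_fin S i j {k, l} ![k, l]
    (fun a b h => by
      fin_cases a <;> fin_cases b <;> first | rfl | exact absurd h hkl | exact absurd h hkl.symm)
    (by ext; simp [eq_comm]), Matrix.det_fin_three]
  change S i j * S k k * S l l - S i j * S k l * S l k - S i k * S k j * S l l +
    S i k * S k l * S l j + S i l * S k j * S l k - S i l * S k k * S l j = listMinor S i j [k, l]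
  unfold listMinor
  ring

theorem listMinor_map_cast {n : ℕ} (S : Matrix (Fin n) (Fin n) ℚ) (i j : Fin n)
    (L : List (Fin n)) :
    listMinor (S.map fun q : ℚ => (q : ℝ)) i j L = ((listMinor S i j L : ℚ) : ℝ) := by
  rcases L with _ | ⟨k, _ | ⟨l, _ | ⟨m, L⟩⟩⟩ <;> simp [listMinor]

/-- One step of symmetric elimination with the pivot at `k`. -/
def pivotStep {n : ℕ} {F : Type*} [Field F] (S : Matrix (Fin n) (Fin n) F) (k : Fin n) :
    Matrix (Fin n) (Fin n) F :=
  fun i j => S i j - S k i * S k j / S k k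

theorem pivotStep_map_cast {n : ℕ} (S : Matrix (Fin n) (Fin n) ℚ) (k : Fin n) :
    pivotStep (S.map fun q : ℚ => (q : ℝ)) k = (pivotStep S k).map fun q : ℚ => (q : ℝ) := by
  ext i j
  simp [pivotStep]

theorem pivotStep_symm {n : ℕ} {S : Matrix (Fin n) (Fin n) ℝ} (h : ∀ i j, S i j = S j i)
    (k i j : Fin n) : pivotStep S k i j = pivotStep S k j i := by
  unfold pivotStep
  rw [h i j, mul_comm (S k i)]

theorem pivotStep_self {n : ℕ} {S : Matrix (Fin n) (Fin n) ℝ} {k : Fin n} (hk : S k k ≠ 0)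
    (j : Fin n) : pivotStep S k k j = 0 := by
  unfold pivotStep
  field_simp
  ring

theorem pivotStep_eq_zero {n : ℕ} {S : Matrix (Fin n) (Fin n) ℝ} (h : ∀ i j, S i j = S j i)
    {m : Fin n} (hm : ∀ j, S m j = 0) (k j : Fin n) : pivotStep S k m j = 0 := by
  unfold pivotStep
  rw [h k m, hm, hm]
  simp

theorem quadraticForm_pivotStep {n : ℕ} (S : Matrix (Fin n) (Fin n) ℝ) (k : Fin n)
    (x : Fin n → ℝ) :
    ∑ i, ∑ j, x i * S i j * x j =
      (∑ j, S k j * x j) ^ 2 / S k k + ∑ i, ∑ j, x i * pivotStep S k i j * x j := by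
  have h : (∑ j, S k j * x j) ^ 2 / S k k = ∑ i, ∑ j, x i * (S k i * S k j / S k k) * x j := by
    rw [sq, Finset.sum_mul_sum, Finset.sum_div]
    refine Finset.sum_congr rfl fun i _ => ?_
    rw [Finset.sum_div]
    exact Finset.sum_congr rfl fun j _ => by ring
  rw [h, ← Finset.sum_add_distrib]
  refine Finset.sum_congr rfl fun i _ => ?_
  rw [← Finset.sum_add_distrib]
  refine Finset.sum_congr rfl fun j _ => ?_
  unfold pivotStep
  ring

/-- A symmetric `4 × 4` matrix all of whose pivots are positive is positive definite. -/
theorem posDef_of_pivots_pos {S : Matrix (Fin 4) (Fin 4) ℝ} (h : ∀ i j, S i j = S j i)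
    (h0 : 0 < S 0 0) (h1 : 0 < pivotStep S 0 1 1) (h2 : 0 < pivotStep (pivotStep S 0) 1 2 2)
    (h3 : 0 < pivotStep (pivotStep (pivotStep S 0) 1) 2 3 3) : S.PosDef := by
  refine Matrix.PosDef.of_dotProduct_mulVec_pos
    (Matrix.IsHermitian.ext fun i j => by rw [star_trivial, h]) fun x hx => ?_
  have hq : star x ⬝ᵥ S *ᵥ x = ∑ i, ∑ j, x i * S i j * x j := by
    simp only [dotProduct, Matrix.mulVec, Finset.mul_sum, Pi.star_apply, star_trivial, mul_assoc]
  rw [hq, quadraticForm_pivotStep S 0, quadraticForm_pivotStep (pivotStep S 0) 1,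
    quadraticForm_pivotStep (pivotStep (pivotStep S 0) 1) 2,
    quadraticForm_pivotStep (pivotStep (pivotStep (pivotStep S 0) 1) 2) 3]
  have s1 := pivotStep_symm h 0
  have s2 := pivotStep_symm s1 1
  have s3 := pivotStep_symm s2 2
  have z10 := pivotStep_self h0.ne'
  have z20 := pivotStep_eq_zero s1 z10 1
  have z30 := pivotStep_eq_zero s2 z20 2
  have z40 := pivotStep_eq_zero s3 z30 3
  have z21 := pivotStep_self h1.ne'
  have z31 := pivotStep_eq_zero s2 z21 2
  have z41 := pivotStep_eq_zero s3 z31 3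
  have z32 := pivotStep_self h2.ne'
  have z42 := pivotStep_eq_zero s3 z32 3
  have z43 := pivotStep_self h3.ne'
  set S1 := pivotStep S 0
  set S2 := pivotStep S1 1
  set S3 := pivotStep S2 2
  set S4 := pivotStep S3 3
  have hS4 : ∑ i, ∑ j, x i * S4 i j * x j = 0 := by
    refine Finset.sum_eq_zero fun i _ => Finset.sum_eq_zero fun j _ => ?_
    have : S4 i j = 0 := by
      fin_cases i
      exacts [z40 j, z41 j, z42 j, z43 j]
    rw [this]; ring
  rw [hS4, add_zero]
  have p0 : 0 ≤ (∑ j, S 0 j * x j) ^ 2 / S 0 0 := by positivity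
  have p1 : 0 ≤ (∑ j, S1 1 j * x j) ^ 2 / S1 1 1 := by positivity
  have p2 : 0 ≤ (∑ j, S2 2 j * x j) ^ 2 / S2 2 2 := by positivity
  have p3 : 0 ≤ (∑ j, S3 3 j * x j) ^ 2 / S3 3 3 := by positivity
  by_contra hle
  have e0 : (∑ j, S 0 j * x j) ^ 2 / S 0 0 = 0 := by linarith
  have e1 : (∑ j, S1 1 j * x j) ^ 2 / S1 1 1 = 0 := by linarith
  have e2 : (∑ j, S2 2 j * x j) ^ 2 / S2 2 2 = 0 := by linarith
  have e3 : (∑ j, S3 3 j * x j) ^ 2 / S3 3 3 = 0 := by linarith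
  have key : ∀ {a b : ℝ}, 0 < b → a ^ 2 / b = 0 → a = 0 := fun hb hab => by
    rcases div_eq_zero_iff.1 hab with h | h
    · exact pow_eq_zero_iff (two_ne_zero) |>.1 h
    · exact absurd h hb.ne'
  have e0 := key h0 e0
  have e1 := key h1 e1
  have e2 := key h2 e2
  have e3 := key h3 e3
  rw [Fin.sum_univ_four] at e0 e1 e2 e3
  have w3 : x 3 = 0 := by
    rw [s3 3 0, s3 3 1, s3 3 2, z30, z31, z32] at e3
    simpa [h3.ne'] using e3
  have w2 : x 2 = 0 := by
    rw [s2 2 0, s2 2 1, z20, z21, w3] at e2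
    simpa [h2.ne'] using e2
  have w1 : x 1 = 0 := by
    rw [s1 1 0, z10, w2, w3] at e1
    simpa [h1.ne'] using e1
  have w0 : x 0 = 0 := by
    rw [w1, w2, w3] at e0
    simpa [h0.ne'] using e0
  refine hx (funext fun i => ?_)
  fin_cases i
  exacts [w0, w1, w2, w3]

theorem tableMatrix_symm (r : Fin 46) (i j : Fin 4) : tableMatrix r i j = tableMatrix r j i := by
  have h : ∀ (r : Fin 46) (i j : Fin 4),
      decide (tableMatrix r i j = tableMatrix r j i) = true := by
    decide +kernel
  exact of_decide_eq_true (h r i j)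

theorem tableMatrix_pivots_pos : ∀ r : Fin 46, 0 < tableMatrix r 0 0 ∧
    0 < pivotStep (tableMatrix r) 0 1 1 ∧
    0 < pivotStep (pivotStep (tableMatrix r) 0) 1 2 2 ∧
    0 < pivotStep (pivotStep (pivotStep (tableMatrix r) 0) 1) 2 3 3 := by
  decide +kernel

theorem tableMatrix_minors : ∀ i j k l : Fin 4, i ≠ j → i ≠ k → i ≠ l → j ≠ k → j ≠ l → k ≠ l →
    ∀ L ∈ [[], [k], [k, l]], ∀ r : Fin 46, r ≠ 35 →
      SignType.sign (listMinor (tableMatrix r) i j L) =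
        if tableDigits.getD r 0 / 10 ^ (23 - position ({i, j}, L.toFinset)) % 10 = 1 then 1
        else -1 := by
  decide +kernel

theorem exists_complement : ∀ i j : Fin 4, i ≠ j → ∀ K : Finset (Fin 4), i ∉ K → j ∉ K →
    ∃ k l : Fin 4, i ≠ k ∧ i ≠ l ∧ j ≠ k ∧ j ≠ l ∧ k ≠ l ∧ (K = ∅ ∨ K = {k} ∨ K = {k, l}) := by
  decide +kernel

theorem sign_rat_cast (q : ℚ) : SignType.sign (q : ℝ) = SignType.sign q := by
  rcases lt_trichotomy q 0 with h | rfl | h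
  · rw [sign_neg h, sign_neg (by exact_mod_cast h)]
  · simp
  · rw [sign_pos h, sign_pos (by exact_mod_cast h)]

theorem realizes_tableMatrix (r : Fin 46) (hr : r ≠ 35) :
    Realizes ((tableMatrix r).map (fun q : ℚ => (q : ℝ))) (tableSign r) := by
  have h := tableMatrix_symm r
  obtain ⟨h0, h1, h2, h3⟩ := tableMatrix_pivots_pos r
  refine ⟨posDef_of_pivots_pos (fun i j => by rw [Matrix.map_apply, Matrix.map_apply, h]) ?_ ?_ ?_
    ?_, fun i j K hij hi hj => ?_⟩
  · rw [Matrix.map_apply]; exact_mod_cast h0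
  · rw [pivotStep_map_cast, Matrix.map_apply]; exact_mod_cast h1
  · rw [pivotStep_map_cast, pivotStep_map_cast, Matrix.map_apply]; exact_mod_cast h2
  · rw [pivotStep_map_cast, pivotStep_map_cast, pivotStep_map_cast, Matrix.map_apply]
    exact_mod_cast h3
  · obtain ⟨k, l, hik, hil, hjk, hjl, hkl, hK⟩ := exists_complement i j hij K hi hj
    have key : ∃ L ∈ [[], [k], [k, l]], K = L.toFinset ∧
        almostPrincipalMinor ((tableMatrix r).map (fun q : ℚ => (q : ℝ))) i j K =
          listMinor ((tableMatrix r).map (fun q : ℚ => (q : ℝ))) i j L := by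
      rcases hK with rfl | rfl | rfl
      · exact ⟨[], by simp, by simp, almostPrincipalMinor_empty _ i j⟩
      · exact ⟨[k], by simp, by simp, almostPrincipalMinor_singleton _ i j k⟩
      · exact ⟨[k, l], by simp, by simp, almostPrincipalMinor_pair _ i j hkl⟩
    obtain ⟨L, hL, rfl, hm⟩ := key
    rw [hm, listMinor_map_cast, sign_rat_cast,
      tableMatrix_minors i j k l hij hik hil hjk hjl hkl L hL r hr]
    rfl

instance Unknown.decidableEq (n : ℕ) : DecidableEq (Unknown n)
  | .p I, .p J => decidable_of_iff (I = J) (by simp)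
  | .p _, .a _ => isFalse (by simp)
  | .a _, .p _ => isFalse (by simp)
  | .a x, .a y => decidable_of_iff (x = y) (by simp)

/-- The edge trinomials of a bi-quadratic final polynomial for row 36 of the table. In each
trinomial, the monomial of the first given term is smaller than that of the second. -/
def finalPolynomialTerms : List (EdgeIndex 4 × Fin 3 × Fin 3 × Fin 3) :=
  [(⟨3, 1, 2, ∅, by decide, by decide, by decide, by decide⟩, 0, 2, 1),
    (⟨2, 0, 1, {0}, by decide, by decide, by decide, by decide⟩, 1, 0, 2),
    (⟨3, 0, 1, {2}, by decide, by decide, by decide, by decide⟩, 2, 0, 1),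
    (⟨2, 1, 3, {3}, by decide, by decide, by decide, by decide⟩, 0, 1, 2),
    (⟨2, 0, 3, {0}, by decide, by decide, by decide, by decide⟩, 0, 1, 2),
    (⟨0, 2, 3, ∅, by decide, by decide, by decide, by decide⟩, 0, 2, 1),
    (⟨0, 1, 2, ∅, by decide, by decide, by decide, by decide⟩, 2, 0, 1)]

theorem finalPolynomialTerms_spec : ∀ x ∈ finalPolynomialTerms,
    x.2.1 ≠ x.2.2.1 ∧ x.2.2.1 ≠ x.2.2.2 ∧ x.2.1 ≠ x.2.2.2 ∧
    SignMap.termSign (tableSign 35) (x.1.term x.2.1) ≠ 0 ∧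
    SignMap.termSign (tableSign 35) (x.1.term x.2.2.2) =
      SignMap.termSign (tableSign 35) (x.1.term x.2.1) ∧
    SignMap.termSign (tableSign 35) (x.1.term x.2.2.1) =
      -SignMap.termSign (tableSign 35) (x.1.term x.2.1) := by
  decide +kernel

theorem finalPolynomialTerms_sum :
    (finalPolynomialTerms.map fun x => (x.1.term x.2.1).monomial).sum =
      (finalPolynomialTerms.map fun x => (x.1.term x.2.2.1).monomial).sum := by
  decide +kernel

theorem hasBiquadraticFinalPolynomial_tableSign :
    HasBiquadraticFinalPolynomial (tableSign 35) := by
  refine ⟨↑(finalPolynomialTerms.map fun x =>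
    ((x.1.term x.2.1).monomial, (x.1.term x.2.2.1).monomial)), ?_, ?_, ?_⟩
  · exact fun h => by simp [finalPolynomialTerms] at h
  · intro q hq
    obtain ⟨x, hx, rfl⟩ := List.mem_map.1 (Multiset.mem_coe.1 hq)
    obtain ⟨h1, h2, h3, h4, h5, h6⟩ := finalPolynomialTerms_spec x hx
    exact ⟨x.1, x.2.1, x.2.2.1, x.2.2.2, h1, h2, h3, h4, h5, h6, rfl, rfl⟩
  · rw [Multiset.map_coe, Multiset.map_coe, List.map_map, List.map_map, Multiset.sum_coe,
      Multiset.sum_coe]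
    exact finalPolynomialTerms_sum

theorem principalMinor_two_pos {n : ℕ} {S : Matrix (Fin n) (Fin n) ℝ} (hS : S.PosDef)
    {i j : Fin n} (hij : i ≠ j) : 0 < S i i * S j j - S i j * S j i := by
  have hinj : Function.Injective ![i, j] := fun a b h => by
    fin_cases a <;> fin_cases b <;>
      first | rfl | exact absurd h hij | exact absurd h hij.symm
  have := (hS.submatrix hinj).det_pos
  rw [Matrix.det_fin_two] at this
  exact this

theorem not_isRealizable_tableSign : ¬ IsRealizable (tableSign 35) := by
  rintro ⟨S, hS, hsign⟩
  have symm : ∀ i j, S j i = S i j := fun i j => by simpa using hS.1.apply i j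
  have pos : ∀ (i j : Fin 4) (K : Finset (Fin 4)) (hij : i ≠ j) (hi : i ∉ K) (hj : j ∉ K),
      tableSign 35 (.of i j K hij hi hj) = 1 → 0 < almostPrincipalMinor S i j K :=
    fun i j K hij hi hj h => sign_eq_one_iff.1 ((hsign i j K hij hi hj).trans h)
  have neg : ∀ (i j : Fin 4) (K : Finset (Fin 4)) (hij : i ≠ j) (hi : i ∉ K) (hj : j ∉ K),
      tableSign 35 (.of i j K hij hi hj) = -1 → almostPrincipalMinor S i j K < 0 :=
    fun i j K hij hi hj h => sign_eq_neg_one_iff.1 ((hsign i j K hij hi hj).trans h)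
  have p0 : 0 < S 0 0 := hS.diag_pos
  have p2 : 0 < S 2 2 := hS.diag_pos
  have p3 : 0 < S 3 3 := hS.diag_pos
  have p02 := principalMinor_two_pos hS (show (0 : Fin 4) ≠ 2 by decide)
  have p23 := principalMinor_two_pos hS (show (2 : Fin 4) ≠ 3 by decide)
  have a01 := pos 0 1 ∅ (by decide) (by decide) (by decide) (by decide +kernel)
  have a02 := pos 0 2 ∅ (by decide) (by decide) (by decide) (by decide +kernel)
  have a03 := pos 0 3 ∅ (by decide) (by decide) (by decide) (by decide +kernel)
  have a12 := pos 1 2 ∅ (by decide) (by decide) (by decide) (by decide +kernel)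
  have a13 := pos 1 3 ∅ (by decide) (by decide) (by decide) (by decide +kernel)
  have a23 := pos 2 3 ∅ (by decide) (by decide) (by decide) (by decide +kernel)
  have a01_2 := pos 0 1 {2} (by decide) (by decide) (by decide) (by decide +kernel)
  have a12_0 := pos 1 2 {0} (by decide) (by decide) (by decide) (by decide +kernel)
  have a03_2 := pos 0 3 {2} (by decide) (by decide) (by decide) (by decide +kernel)
  have a13_2 := pos 1 3 {2} (by decide) (by decide) (by decide) (by decide +kernel)
  have a01_23 := pos 0 1 {2, 3} (by decide) (by decide) (by decide) (by decide +kernel)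
  have a12_3 := neg 1 2 {3} (by decide) (by decide) (by decide) (by decide +kernel)
  have a23_0 := neg 2 3 {0} (by decide) (by decide) (by decide) (by decide +kernel)
  rw [almostPrincipalMinor_empty, listMinor] at a01 a02 a03 a12 a13 a23
  rw [almostPrincipalMinor_singleton, listMinor] at a01_2 a12_0 a03_2 a13_2 a12_3 a23_0
  rw [almostPrincipalMinor_pair _ _ _ (by decide), listMinor] at a01_23
  simp only [symm 0 1, symm 0 2, symm 1 2, symm 1 3, symm 2 3] at *
  have m1 : S 3 3 * S 1 2 < S 1 3 * S 2 3 := by linarith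
  have m2 : S 0 0 * (S 0 1 * S 2 2 - S 0 2 * S 1 2) < (S 0 0 * S 2 2 - S 0 2 * S 0 2) * S 0 1 := by
    linear_combination mul_pos a02 a12_0
  have m3 : (S 0 3 * S 2 2 - S 0 2 * S 2 3) * (S 1 3 * S 2 2 - S 1 2 * S 2 3) <
      (S 2 2 * S 3 3 - S 2 3 * S 2 3) * (S 0 1 * S 2 2 - S 0 2 * S 1 2) := by
    linear_combination mul_pos p2 a01_23
  have m4 : (S 2 2 * S 3 3 - S 2 3 * S 2 3) * S 1 3 <
      S 3 3 * (S 1 3 * S 2 2 - S 1 2 * S 2 3) := by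
    linear_combination mul_neg_of_neg_of_pos a12_3 a23
  have m5 : (S 0 0 * S 2 2 - S 0 2 * S 0 2) * S 0 3 <
      S 0 0 * (S 0 3 * S 2 2 - S 0 2 * S 2 3) := by
    linear_combination mul_neg_of_neg_of_pos a23_0 a02
  have m6 : S 0 0 * S 2 3 < S 0 2 * S 0 3 := by linarith
  have m7 : S 0 1 * S 0 2 < S 0 0 * S 1 2 := by linarith
  have key := mul_lt_mul'' (mul_lt_mul'' (mul_lt_mul'' m1 m2 (by positivity) (by positivity))
    (mul_lt_mul'' m3 m4 (by positivity) (by positivity)) (by positivity) (by positivity))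
    (mul_lt_mul'' (mul_lt_mul'' m5 m6 (by positivity) (by positivity)) m7 (by positivity)
      (by positivity)) (by positivity) (by positivity)
  refine key.ne ?_
  generalize S 0 1 * S 2 2 - S 0 2 * S 1 2 = b1
  generalize S 0 0 * S 2 2 - S 0 2 * S 0 2 = b2
  generalize S 0 3 * S 2 2 - S 0 2 * S 2 3 = b3
  generalize S 1 3 * S 2 2 - S 1 2 * S 2 3 = b4
  generalize S 2 2 * S 3 3 - S 2 3 * S 2 3 = b5
  ring

theorem mainTheorem9 :
    (uniformSymmetryClasses 4).ncard = 46 ∧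
    (∀ r : Fin 46, IsUniformOrientedGaussoid (tableSign r)) ∧
    Set.BijOn (fun r : Fin 46 => symmetryClass (tableSign r)) Set.univ
      (uniformSymmetryClasses 4) ∧
    (∀ r : Fin 46, r ≠ 35 →
      Realizes ((tableMatrix r).map (fun q : ℚ => (q : ℝ))) (tableSign r)) ∧
    (∀ O ∈ uniformSymmetryClasses 4, O ≠ symmetryClass (tableSign 35) →
      ∀ φ ∈ O, IsRealizable φ) ∧
    (∀ φ ∈ symmetryClass (tableSign 35), ¬ IsRealizable φ) ∧
    (∀ φ ∈ symmetryClass (tableSign 35), HasBiquadraticFinalPolynomial φ) := by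
  have hbij : Set.BijOn (fun r : Fin 46 => symmetryClass (tableSign r)) Set.univ
      (uniformSymmetryClasses 4) := by
    refine ⟨fun r _ => ⟨tableSign r, isUniformOrientedGaussoid_tableSign r, rfl⟩,
      fun r _ s _ h => ?_, ?_⟩
    · have h : symmetryClass (tableSign r) = symmetryClass (tableSign s) := h
      have hs : tableSign s ∈ symmetryClass (tableSign r) := h ▸ MulAction.mem_orbit_self _
      obtain ⟨g, hg⟩ := hs
      exact tableSign_orbit_injective hg
    · rintro O ⟨φ, hφ, rfl⟩
      obtain ⟨r, g, rfl⟩ := exists_tableSign_smul_eq hφ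
      exact ⟨r, Set.mem_univ r, (MulAction.orbit_smul g (tableSign r)).symm⟩
  refine ⟨?_, isUniformOrientedGaussoid_tableSign, hbij, realizes_tableMatrix, ?_, ?_, ?_⟩
  · rw [← hbij.image_eq, hbij.injOn.ncard_image, Set.ncard_univ, Nat.card_fin]
  · intro O hO hne φ hφ
    obtain ⟨r, -, rfl⟩ := hbij.surjOn hO
    obtain ⟨g, rfl⟩ := hφ
    refine IsRealizable.smul ⟨_, realizes_tableMatrix r ?_⟩ g
    rintro rfl
    exact hne rfl
  · rintro φ ⟨g, rfl⟩ h
    refine not_isRealizable_tableSign ?_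
    have := h.smul g⁻¹
    rwa [inv_smul_smul] at this
  · rintro φ ⟨g, rfl⟩
    exact hasBiquadraticFinalPolynomial_tableSign.smul g
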